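/- Let $A$ be a finite set. A payoff is a function $\varphi\colon A^\omega\to\mathbb{R}$; it is continuous if it is continuous for the product topology on $A^\omega$ of the discrete topology on $A$. It is multi-discounted if there are $\lambda\colon A\to[0,1)$ and $w\colon A\to\mathbb{R}$ such that $$\varphi(a_1a_2a_3\ldots)=\sum_{n=1}^\infty \lambda(a_1)\cdots\lambda(a_{n-1})\,w(a_n)\qquad\text{for all } a_1a_2a_3\ldots\in A^\omega .$$ An $A$-labeled Markov decision process (MDP) consists of a finite set $S$ of states, a finite set $\mathrm{Act}\subseteq S\times\Delta(S)$ of actions, where $\Delta(S)$ is the set of probability distributions on $S$, such that every $s\in S$ has an action $(s,P)\in\mathrm{Act}$, and a labeling $\mathrm{lab}\colon\mathrm{Act}\times S\to A$. A finite history is a state $s_0$ followed by a finite, possibly empty, sequence $(e_1,s_1)\ldots(e_n,s_n)$ of elements of $\mathrm{Act}\times S$ such that the first component of $e_i$ is $s_{i-1}$ for each $i$; it ends in $s_n$. A strategy $\sigma$ assigns to every finite history that ends in $s$ an action with first component $s$; it is positional if this action depends only on $s$. From a state $s$, a strategy induces in the usual way a Borel probability measure $\mathcal{P}^\sigma_s$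 on $(\mathrm{Act}\times S)^\omega$. It is optimal for $\varphi$ if it maximizes $\mathbb{E}_{\mathcal{H}\sim\mathcal{P}^\sigma_s}\,\varphi(\mathrm{lab}(\mathcal{H}))$ among all strategies, for every state $s$ simultaneously. A continuous payoff $\varphi$ is positionally determined in MDPs if every $A$-labeled MDP has a positional strategy that is optimal for $\varphi$. An $A$-labeled game graph consists of a finite set $V$ of nodes, partitioned into nodes of Max and nodes of Min, and a set $E\subseteq V\times A\times V$ of edges, such that every node has an outgoing edge. A strategy of a player assigns to every finite path (of length $0$ or more) that ends in a node of that player an edge going out of that node; it is positional if this edge depends only on the node. The value at $s\in V$ of a strategy of Max (of Min) is the infimum (the supremum) of $\varphi$ over the label sequences of all infinite paths from $s$ consistent with it. The payoff $\varphi$ is positionally determined if in every $A$-labeled game graph there are positional strategies of Max and of Min that have the same value at every node. It is positional in one-player deterministic games if in every $A$-labeled game graph all of whose nodes belong to Max there is a positional strategy of Max whose value at every node is at least that of any other strategy of Max. **Theorem.** 1. For every finite set $A$ and every continuous payoff $\varphi\colon A^\omega\to\mathbb{R}$, $\varphi$ is positionally determined in MDPs if and only if it is multi-discounted. 2. There exist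 a finite set $A$ and a continuous payoff $\varphi\colon A^\omega\to\mathbb{R}$ which is positionally determined, and also positional in one-player deterministic games, but which is not positionally determined in MDPs. In particular, Gimbert's conjecture that every payoff which is positional in one-player deterministic games is positional in MDPs is false. -/

import Mathlib

open MeasureTheory
open scoped ENNReal

/-! ### Words, payoffs

An infinite word over `A` is a function `ℕ → A` (letters are numbered from `0`), and a payoff is a
function `(ℕ → A) → ℝ`. -/

/-- The finite word `l` is a prefix of the infinite word `x`. -/
def IsPrefix {α : Type*} (l : List α) (x : ℕ → α) : Prop :=
  ∀ (i : ℕ) (hi : i < l.length), x i = l[i]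

/-- Continuity of a payoff for the product topology of the discrete topology on `A`. -/
def ContinuousPayoff {A : Type*} (φ : (ℕ → A) → ℝ) : Prop :=
  letI : TopologicalSpace A := ⊥
  Continuous φ

/-- `φ(a₁ a₂ a₃ …) = ∑ₙ λ(a₁) ⋯ λ(aₙ₋₁) w(aₙ)` for some `λ : A → [0, 1)` and `w : A → ℝ`. -/
def MultiDiscounted {A : Type*} (φ : (ℕ → A) → ℝ) : Prop :=
  ∃ (lam w : A → ℝ), (∀ a, 0 ≤ lam a ∧ lam a < 1) ∧
    ∀ α : ℕ → A, HasSum (fun n => (∏ i ∈ Finset.range n, lam (α i)) * w (α n)) (φ α)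

/-- The list of edges `l` (with given sources and targets) is a walk that starts in `s`. -/
def IsWalk {V E : Type*} (src tgt : E → V) : V → List E → Prop
  | _, [] => True
  | s, e :: l => src e = s ∧ IsWalk src tgt (tgt e) l

/-- The endpoint of the walk `l` that starts in `s`. -/
def walkEnd {V E : Type*} (tgt : E → V) : V → List E → V
  | s, [] => s
  | _, e :: l => walkEnd tgt (tgt e) l

theorem IsWalk.snoc {V E : Type*} {src tgt : E → V} {s : V} {l : List E} (h : IsWalk src tgt s l)
    (e : E) (he : src e = walkEnd tgt s l) : IsWalk src tgt s (l ++ [e]) := by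
  induction l generalizing s with
  | nil => exact ⟨he, trivial⟩
  | cons d l ih => exact ⟨h.1, ih h.2 he⟩

/-! ### Markov decision processes -/

/-- An `A`-labeled Markov decision process: a finite set of states, a finite set of actions
`(s, P)` with `P` a probability distribution on the states, and a label for every pair of an action
and a state. Every state has at least one action. -/
structure MDP (A : Type*) where
  State : Type
  [finite_state : Finite State]
  Act : Finset (State × PMF State)
  lab : Act → State → A
  exists_act : ∀ s : State, ∃ P : PMF State, (s, P) ∈ Act

namespace MDP

variable {A : Type*} (M : MDP A)

/-- The state in which an action is available. -/
def source (e : M.Act) : M.State := e.1.1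

/-- The distribution of the next state under an action. -/
def dist (e : M.Act) : PMF M.State := e.1.2

/-- Transitions: pairs of an action and the state to which it led. -/
@[ext]
structure Transition where
  act : M.Act
  next : M.State

/-- The label of a transition. -/
def label (t : M.Transition) : A := M.lab t.act t.next

/-- The (finite) set of transitions carries the discrete `σ`-algebra, so that the product
`σ`-algebra on `ℕ → M.Transition` is the Borel `σ`-algebra. -/
instance : MeasurableSpace M.Transition := ⊤

/-- Finite histories: consistent finite sequences of transitions that start in a given state,
including the history of length `0` at every state. -/
structure History where
  start : M.State
  steps : List M.Transition
  isWalk : IsWalk (fun t : M.Transition => M.source t.act) Transition.next start steps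

variable {M}

/-- The last state of a history. -/
def History.target (h : M.History) : M.State := walkEnd Transition.next h.start h.steps

/-- The history of length `0` at the state `s`. -/
def History.nil (s : M.State) : M.History := ⟨s, [], trivial⟩

/-- A history extended by one transition. -/
def History.snoc (h : M.History) (t : M.Transition) (ht : M.source t.act = h.target) :
    M.History :=
  ⟨h.start, h.steps ++ [t], h.isWalk.snoc t ht⟩

variable (M)

/-- A strategy chooses, after every finite history, an action that is available in its last
state. -/
structure Strategy where
  act : M.History → M.Act
  source_act : ∀ h, M.source (act h) = h.target

variable {M}

/-- A strategy is positional if its choice depends only on the last state. -/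
def Strategy.Positional (σ : M.Strategy) : Prop :=
  ∀ h₁ h₂ : M.History, h₁.target = h₂.target → σ.act h₁ = σ.act h₂

open Classical in
/-- The probability that, once the history `h` has occurred, the strategy `σ` generates the
sequence of transitions `l` next: the product over the transitions `t` of `l` of the probability of
`t.next` under `t.act`, or `0` as soon as some `t.act` is not the action that `σ` plays at that
moment. -/
noncomputable def Strategy.prob (σ : M.Strategy) : M.History → List M.Transition → ℝ≥0∞
  | _, [] => 1
  | h, t :: l =>
    if ht : t.act = σ.act h then
      M.dist t.act t.next * σ.prob (h.snoc t ((congrArg M.source ht).trans (σ.source_act h))) l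
    else 0

/-! Existence and uniqueness of the probability measure on infinite sequences of transitions with
prescribed values on cylinders. -/

instance (M : MDP A) : Finite M.State := M.finite_state

instance (M : MDP A) : Finite M.Transition :=
  Finite.of_injective (fun t : M.Transition => (t.act, t.next)) fun t t' h => by
    cases t; cases t'; simp_all

instance (M : MDP A) : MeasurableSpace M.State := ⊤

/-- The play from `h` under `σ` if the state after the history `g` is drawn as `ω g`. -/
def Strategy.run (σ : M.Strategy) (ω : M.History → M.State) : M.History → ℕ → M.Transition
  | h, 0 => ⟨σ.act h, ω h⟩
  | h, n + 1 => σ.run ω (h.snoc ⟨σ.act h, ω h⟩ (σ.source_act h)) n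

theorem isPrefix_cons {α : Type*} (a : α) (l : List α) (x : ℕ → α) :
    IsPrefix (a :: l) x ↔ x 0 = a ∧ IsPrefix l (fun n => x (n + 1)) := by
  constructor
  · intro h
    exact ⟨h 0 (by simp), fun i hi => h (i + 1) (by simpa using hi)⟩
  · rintro ⟨h0, h⟩ i hi
    cases i with
    | zero => exact h0
    | succ i => exact h i (by simpa using hi)

theorem Strategy.isPrefix_run_cons (σ : M.Strategy) (ω : M.History → M.State) (h : M.History)
    (t : M.Transition) (ht : t.act = σ.act h) (l : List M.Transition) :
    IsPrefix (t :: l) (σ.run ω h) ↔ ω h = t.next ∧ IsPrefix l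
      (σ.run ω (h.snoc t ((congrArg M.source ht).trans (σ.source_act h)))) := by
  rw [isPrefix_cons]
  obtain ⟨a, s⟩ := t
  simp only at ht
  subst ht
  constructor
  · rintro ⟨h0, h1⟩
    have h2 : ω h = s := congrArg Transition.next h0
    subst h2
    exact ⟨rfl, h1⟩
  · rintro ⟨h2, h1⟩
    subst h2
    exact ⟨rfl, h1⟩

theorem Strategy.measurable_run (σ : M.Strategy) (h : M.History) (n : ℕ) :
    Measurable fun ω : M.History → M.State => σ.run ω h n := by
  induction n generalizing h with
  | zero =>
    have h1 : Measurable fun s : M.State => (⟨σ.act h, s⟩ : M.Transition) := fun _ _ => trivial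
    exact h1.comp (measurable_pi_apply h)
  | succ n ih =>
    have : ∀ s : M.State, Measurable fun ω : M.History → M.State =>
        σ.run ω (h.snoc ⟨σ.act h, s⟩ (σ.source_act h)) n := fun s => ih _
    have h2 : Measurable fun p : M.State × (M.History → M.State) =>
        σ.run p.2 (h.snoc ⟨σ.act h, p.1⟩ (σ.source_act h)) n :=
      measurable_from_prod_countable_right this
    have h3 : Measurable fun ω : M.History → M.State => (ω h, ω) :=
      Measurable.prodMk (measurable_pi_apply h) measurable_id
    exact h2.comp h3

open Classical in
theorem Strategy.infinitePi_run (σ : M.Strategy) (l : List M.Transition) (h : M.History)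
    (F : Finset M.History) (c : M.History → M.State)
    (hF : ∀ f ∈ F, f.steps.length < h.steps.length) :
    Measure.infinitePi (fun g => (M.dist (σ.act g)).toMeasure)
      {ω | (∀ f ∈ F, ω f = c f) ∧ IsPrefix l (σ.run ω h)} =
      (∏ f ∈ F, M.dist (σ.act f) (c f)) * σ.prob h l := by
  induction l generalizing h F c with
  | nil =>
    have : {ω : M.History → M.State | (∀ f ∈ F, ω f = c f) ∧ IsPrefix [] (σ.run ω h)} =
        Set.pi (F : Set M.History) fun f => {c f} := by
      ext ω
      simp [IsPrefix, Set.pi]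
    rw [this, Measure.infinitePi_pi _ fun _ _ => MeasurableSpace.measurableSet_top]
    have hs : ∀ f : M.History, (M.dist (σ.act f)).toMeasure {c f} = M.dist (σ.act f) (c f) :=
      fun f => PMF.toMeasure_apply_singleton _ _ MeasurableSpace.measurableSet_top
    simp [Strategy.prob, hs]
  | cons t l ih =>
    by_cases ht : t.act = σ.act h
    · have hh : h ∉ F := fun hm => lt_irrefl _ (hF h hm)
      have key := ih (h.snoc t ((congrArg M.source ht).trans (σ.source_act h))) (insert h F)
        (Function.update c h t.next) (by
          intro f hf
          rcases Finset.mem_insert.1 hf with rfl | hf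
          · simp [History.snoc]
          · have := hF f hf
            simp only [History.snoc, List.length_append, List.length_singleton]
            omega)
      have hset : {ω : M.History → M.State |
            (∀ f ∈ F, ω f = c f) ∧ IsPrefix (t :: l) (σ.run ω h)} =
          {ω | (∀ f ∈ insert h F, ω f = Function.update c h t.next f) ∧ IsPrefix l
            (σ.run ω (h.snoc t ((congrArg M.source ht).trans (σ.source_act h))))} := by
        ext ω
        have hne : ∀ f ∈ F, Function.update c h t.next f = c f := fun f hf =>
          Function.update_of_ne (ne_of_mem_of_not_mem hf hh) _ _
        simp only [Set.mem_ofPred_eq, σ.isPrefix_run_cons ω h t ht, Finset.forall_mem_insert,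
          Function.update_self]
        constructor
        · rintro ⟨h1, h2, h3⟩
          exact ⟨⟨h2, fun f hf => (h1 f hf).trans (hne f hf).symm⟩, h3⟩
        · rintro ⟨⟨h2, h1⟩, h3⟩
          exact ⟨fun f hf => (h1 f hf).trans (hne f hf), h2, h3⟩
      rw [hset, key, Finset.prod_insert hh, Function.update_self, Strategy.prob, dif_pos ht,
        Finset.prod_congr rfl fun f hf =>
          congrArg _ (Function.update_of_ne (ne_of_mem_of_not_mem hf hh) _ _),
        show M.dist t.act = M.dist (σ.act h) from congrArg _ ht]
      ring
    · have : {ω : M.History → M.State |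
          (∀ f ∈ F, ω f = c f) ∧ IsPrefix (t :: l) (σ.run ω h)} = ∅ := by
        ext ω
        simp only [Set.mem_ofPred_eq, Set.mem_empty_iff_false, iff_false, not_and, isPrefix_cons]
        intro _ h0
        exact absurd (congrArg Transition.act h0).symm ht
      rw [this, Strategy.prob, dif_neg ht]
      simp

theorem measurableSet_isPrefix (l : List M.Transition) :
    MeasurableSet {x : ℕ → M.Transition | IsPrefix l x} := by
  simp only [IsPrefix, Set.ofPred_forall]
  exact MeasurableSet.iInter fun i => MeasurableSet.iInter fun hi =>
    measurable_pi_apply (X := fun _ : ℕ => M.Transition) i (t := {l[i]}) trivial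

theorem measure_ext_isPrefix (μ ν : Measure (ℕ → M.Transition)) [IsFiniteMeasure μ]
    (h : ∀ l : List M.Transition, μ {x | IsPrefix l x} = ν {x | IsPrefix l x}) : μ = ν := by
  refine ext_of_generate_finite
    (Set.range fun l : List M.Transition => {x : ℕ → M.Transition | IsPrefix l x}) ?_ ?_ ?_ ?_
  · apply le_antisymm
    · refine iSup_le fun n => ?_
      rw [MeasurableSpace.comap_le_iff_le_map]
      intro B _
      have hB : (fun x : ℕ → M.Transition => x n) ⁻¹' B =
          ⋃ l ∈ {l : List M.Transition | ∃ t ∈ B, l[n]? = some t},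
            {x : ℕ → M.Transition | IsPrefix l x} := by
        ext x
        simp only [Set.mem_preimage, Set.mem_iUnion, Set.mem_ofPred_eq, exists_prop]
        constructor
        · intro hx
          refine ⟨(List.range (n + 1)).map x, ⟨x n, hx, by simp⟩, ?_⟩
          intro i hi
          simp
        · rintro ⟨l, ⟨t, ht, hl⟩, hx⟩
          obtain ⟨hn, rfl⟩ := List.getElem?_eq_some_iff.1 hl
          rwa [hx n hn]
      change MeasurableSet[MeasurableSpace.generateFrom _] _
      rw [hB]
      exact MeasurableSet.biUnion (Set.to_countable _) fun l _ =>
        MeasurableSpace.measurableSet_generateFrom ⟨l, rfl⟩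
    · refine MeasurableSpace.generateFrom_le ?_
      rintro _ ⟨l, rfl⟩
      exact measurableSet_isPrefix l
  · have aux : ∀ l l' : List M.Transition, l.length ≤ l'.length →
        ({x : ℕ → M.Transition | IsPrefix l x} ∩ {x | IsPrefix l' x}).Nonempty →
        {x : ℕ → M.Transition | IsPrefix l x} ∩ {x | IsPrefix l' x} = {x | IsPrefix l' x} := by
      rintro l l' hle ⟨y, hy, hy'⟩
      refine Set.inter_eq_right.2 fun x hx i hi => ?_
      rw [← hy i hi, hy' i (hi.trans_le hle), hx i (hi.trans_le hle)]
    rintro _ ⟨l, rfl⟩ _ ⟨l', rfl⟩ hne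
    rcases le_total l.length l'.length with hle | hle
    · exact ⟨l', (aux l l' hle hne).symm⟩
    · exact ⟨l, by rw [Set.inter_comm] at hne ⊢; exact (aux l' l hle hne).symm⟩
  · rintro _ ⟨l, rfl⟩
    exact h l
  · simpa [IsPrefix] using h []

theorem Strategy.existsUnique_playMeasure (σ : M.Strategy) (s : M.State) :
    ∃! μ : Measure (ℕ → M.Transition),
      ∀ l : List M.Transition, μ {x | IsPrefix l x} = σ.prob (History.nil s) l := by
  have hm : Measurable fun ω : M.History → M.State => σ.run ω (History.nil s) :=
    measurable_pi_lambda _ fun n => σ.measurable_run _ n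
  refine ⟨(Measure.infinitePi (fun g => (M.dist (σ.act g)).toMeasure)).map
    fun ω => σ.run ω (History.nil s), ?_, ?_⟩
  · intro l
    rw [Measure.map_apply hm (measurableSet_isPrefix l)]
    simpa using σ.infinitePi_run l (History.nil s) ∅ (fun g => g.target) (by simp)
  · intro ν hν
    have : IsFiniteMeasure ν := ⟨by
      have := hν []
      simp only [IsPrefix, List.length_nil, Nat.not_lt_zero, IsEmpty.forall_iff, implies_true,
        Set.ofPred_true, Strategy.prob] at this
      simp [this]⟩
    refine measure_ext_isPrefix _ _ fun l => ?_
    rw [hν l, Measure.map_apply hm (measurableSet_isPrefix l)]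
    simpa using (σ.infinitePi_run l (History.nil s) ∅ (fun g => g.target) (by simp)).symm

/-- The law of the infinite sequence of transitions generated by `σ` from the state `s`: the unique
measure under which, for every finite sequence `l` of transitions, the cylinder of `l` has the
probability that `σ` generates `l` from `s`. -/
noncomputable def Strategy.playMeasure (σ : M.Strategy) (s : M.State) :
    Measure (ℕ → M.Transition) :=
  (σ.existsUnique_playMeasure s).choose

theorem Strategy.playMeasure_isPrefix (σ : M.Strategy) (s : M.State) (l : List M.Transition) :
    σ.playMeasure s {x | IsPrefix l x} = σ.prob (History.nil s) l :=
  (σ.existsUnique_playMeasure s).choose_spec.1 l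

instance (σ : M.Strategy) (s : M.State) : IsProbabilityMeasure (σ.playMeasure s) :=
  ⟨by simpa [IsPrefix, Strategy.prob] using σ.playMeasure_isPrefix s []⟩

/-- The expected payoff of the strategy `σ` from the state `s`. -/
noncomputable def Strategy.value (φ : (ℕ → A) → ℝ) (σ : M.Strategy) (s : M.State) : ℝ :=
  ∫ x, φ (fun n => M.label (x n)) ∂(σ.playMeasure s)

/-- A strategy is optimal if it maximizes the expected payoff from every state. -/
def Strategy.Optimal (φ : (ℕ → A) → ℝ) (σ : M.Strategy) : Prop :=
  ∀ (σ' : M.Strategy) (s : M.State), σ'.value φ s ≤ σ.value φ s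

end MDP

/-- Every `A`-labeled MDP has an optimal strategy which is positional. (The definition is meant for
bounded measurable payoffs.) -/
def PositionallyDeterminedInMDPs {A : Type*} (φ : (ℕ → A) → ℝ) : Prop :=
  ∀ M : MDP A, ∃ σ : M.Strategy, σ.Positional ∧ σ.Optimal φ

/-! ### Deterministic games on finite graphs -/

/-- An `A`-labeled game graph (`A` is meant to be finite). The nodes outside `VMax` are those of
Min. Every node has an outgoing edge. -/
structure GameGraph (A : Type*) where
  V : Type
  [finite_V : Finite V]
  VMax : Set V
  E : Set (V × A × V)
  exists_edge : ∀ s : V, ∃ (a : A) (t : V), (s, a, t) ∈ E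

namespace GameGraph

variable {A : Type*} (G : GameGraph A)

/-- The nodes of Min. -/
def VMin : Set G.V := G.VMaxᶜ

variable {G}

def source (e : G.E) : G.V := e.1.1

def lab (e : G.E) : A := e.1.2.1

def target (e : G.E) : G.V := e.1.2.2

variable (G)

/-- Finite paths, including the path of length `0` at every node. -/
structure Path where
  start : G.V
  edges : List G.E
  isWalk : IsWalk source target start edges

/-- The last node of a finite path. -/
def Path.last {G : GameGraph A} (p : G.Path) : G.V := walkEnd target p.start p.edges

/-- Strategies of the player who owns the set `W` of nodes: an outgoing edge of the last node of
every finite path that ends in `W`. -/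
structure Strategy (W : Set G.V) where
  move : ∀ p : G.Path, p.last ∈ W → G.E
  source_move : ∀ (p : G.Path) (hp : p.last ∈ W), source (move p hp) = p.last

variable {G}

/-- A strategy is positional if its choice depends only on the last node. -/
def Strategy.Positional {W : Set G.V} (σ : G.Strategy W) : Prop :=
  ∀ (p q : G.Path) (hp : p.last ∈ W) (hq : q.last ∈ W), p.last = q.last → σ.move p hp = σ.move q hq

/-- The infinite paths from the node `s` that are consistent with the strategy `σ`. -/
def Strategy.Cons {W : Set G.V} (σ : G.Strategy W) (s : G.V) : Set (ℕ → G.E) :=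
  {P | source (P 0) = s ∧ (∀ n, source (P (n + 1)) = target (P n)) ∧
    ∀ (p : G.Path) (hp : p.last ∈ W), p.start = s → IsPrefix p.edges P →
      P p.edges.length = σ.move p hp}

/-- The value of a strategy of Max in the node `s`: the infimum, in the extended reals, of the
payoff over the infinite paths from `s` that are consistent with it. -/
noncomputable def maxValue (φ : (ℕ → A) → ℝ) (σ : G.Strategy G.VMax) (s : G.V) : EReal :=
  ⨅ P ∈ σ.Cons s, (φ (fun n => lab (P n)) : EReal)

/-- The value of a strategy of Min in the node `s`: the corresponding supremum. -/
noncomputable def minValue (φ : (ℕ → A) → ℝ) (τ : G.Strategy G.VMin) (s : G.V) : EReal :=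
  ⨆ P ∈ τ.Cons s, (φ (fun n => lab (P n)) : EReal)

/-- A pair of strategies of Max and Min is an equilibrium if they have the same value in every
node. -/
def IsEquilibrium (φ : (ℕ → A) → ℝ) (σ : G.Strategy G.VMax) (τ : G.Strategy G.VMin) : Prop :=
  ∀ s : G.V, maxValue φ σ s = minValue φ τ s

/-- A strategy of Max is optimal if it has the largest value in every node. -/
def MaxOptimal (φ : (ℕ → A) → ℝ) (σ : G.Strategy G.VMax) : Prop :=
  ∀ (σ' : G.Strategy G.VMax) (s : G.V), maxValue φ σ' s ≤ maxValue φ σ s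

end GameGraph

/-- Every `A`-labeled game graph has an equilibrium of two positional strategies. -/
def PositionallyDetermined {A : Type*} (φ : (ℕ → A) → ℝ) : Prop :=
  ∀ G : GameGraph A, ∃ (σ : G.Strategy G.VMax) (τ : G.Strategy G.VMin),
    σ.Positional ∧ τ.Positional ∧ GameGraph.IsEquilibrium φ σ τ

/-- In every `A`-labeled game graph all of whose nodes belong to Max, Max has an optimal strategy
which is positional. -/
def PositionalInOnePlayerGames {A : Type*} (φ : (ℕ → A) → ℝ) : Prop :=
  ∀ G : GameGraph A, G.VMax = Set.univ →
    ∃ σ : G.Strategy G.VMax, σ.Positional ∧ GameGraph.MaxOptimal φ σ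

/-! ### Words -/

/-! On a finite alphabet, multi-discounted payoffs are the bounded ones with a recursion φ(ax) =
w(a) + λ(a) φ(x), where all λ(a) lie in [0, Λ] for some Λ < 1. The first claim thus concerns
prefixing with a letter.

From the recursion to MDPs: the Bellman operator is a Λ-contraction. Its fixed point V bounds the
value of every strategy, and playing an action that attains the Bellman maximum in each state
achieves V (`exists_bellman`, `IsMultiDiscounted.positionallyDeterminedInMDPs`).

Conversely, let an MDP offer a choice between two lotteries over words, either immediately or after
a letter a. A positional optimal strategy chooses the same in both situations, so a strict
preference under φ is never reversed under g(x) = φ(ax) (`PositionallyDeterminedInMDPs.lottery_le`).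
As in the uniqueness of von Neumann–Morgenstern utilities, g is therefore a nondecreasing affine
function of φ (`PositionallyDeterminedInMDPs.exists_affine`). The slope is below 1 because prefixing
with a over and over makes all words converge to aaa…, and φ is continuous
(`lt_one_of_consWord_eq`).

For the second claim: optimality in deterministic games depends only on the order of payoffs, so an
increasing function of a multi-discounted payoff keeps its positional equilibria (`Guarantee.comp`),
while expectations do not respect such a change. The cube of a discounted payoff is no longer
multi-discounted, hence fails in MDPs by the first claim. -/

/-- The word `x` preceded by the letter `a`. -/
def consWord {α : Type*} (a : α) (x : ℕ → α) : ℕ → α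
  | 0 => a
  | n + 1 => x n

@[simp] theorem consWord_zero {α : Type*} (a : α) (x : ℕ → α) : consWord a x 0 = a := rfl

@[simp] theorem consWord_succ {α : Type*} (a : α) (x : ℕ → α) (n : ℕ) :
    consWord a x (n + 1) = x n := rfl

theorem comp_consWord {α β : Type*} (f : α → β) (a : α) (x : ℕ → α) :
    (fun n => f (consWord a x n)) = consWord (f a) (fun n => f (x n)) := by
  funext n; cases n <;> rfl

theorem ContinuousPayoff.comp_consWord {A : Type*} {φ : (ℕ → A) → ℝ} (hφ : ContinuousPayoff φ)
    (a : A) : ContinuousPayoff fun x => φ (consWord a x) := by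
  let _ : TopologicalSpace A := ⊥
  refine Continuous.comp (g := φ) hφ (continuous_pi fun n => ?_)
  cases n with
  | zero => exact continuous_const
  | succ n => exact continuous_apply n

theorem ContinuousPayoff.exists_bound {A : Type*} [Finite A] {φ : (ℕ → A) → ℝ}
    (hφ : ContinuousPayoff φ) : ∃ C, 0 ≤ C ∧ ∀ x, |φ x| ≤ C := by
  let _ : TopologicalSpace A := ⊥
  have : DiscreteTopology A := ⟨rfl⟩
  obtain ⟨C, hC⟩ := isCompact_univ.exists_bound_of_continuousOn
    (f := φ) (Continuous.continuousOn hφ)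
  exact ⟨max C 0, le_max_right _ _, fun x => (hC x trivial).trans (le_max_left _ _)⟩

/-! ### Strategies after the first transition -/

namespace MDP

variable {A : Type*} {M : MDP A}

/-- The history `h` preceded by the transition `t`. -/
def History.cons (t : M.Transition) (h : M.History) (hh : h.start = t.next) : M.History :=
  ⟨M.source t.act, t :: h.steps, rfl, hh ▸ h.isWalk⟩

theorem History.target_cons (t : M.Transition) (h : M.History) (hh : h.start = t.next) :
    (h.cons t hh).target = h.target := by
  simp [History.target, History.cons, walkEnd, hh]

open Classical in
/-- The strategy that plays as `σ` does if the transition `t` has already occurred. -/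
noncomputable def Strategy.shift (σ : M.Strategy) (t : M.Transition) : M.Strategy where
  -- Histories that cannot follow `t` are irrelevant to the play; the default `σ.act h` makes a
  -- positional strategy literally equal to its shift.
  act h := if hh : h.start = t.next then σ.act (h.cons t hh) else σ.act h
  source_act h := by
    by_cases hh : h.start = t.next
    · simp only [hh, dif_pos]
      rw [σ.source_act, History.target_cons]
    · simp only [hh, dif_neg, not_false_iff, σ.source_act]

theorem Strategy.shift_act (σ : M.Strategy) (t : M.Transition) (h : M.History)
    (hh : h.start = t.next) : (σ.shift t).act h = σ.act (h.cons t hh) := by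
  simp [Strategy.shift, hh]

theorem Strategy.Positional.shift_eq {σ : M.Strategy} (hσ : σ.Positional) (t : M.Transition) :
    σ.shift t = σ := by
  have h : (σ.shift t).act = σ.act := by
    funext h
    by_cases hh : h.start = t.next
    · rw [σ.shift_act t h hh]
      exact hσ _ _ (h.target_cons t hh)
    · simp [Strategy.shift, hh]
  cases σ
  simpa only [Strategy.shift, Strategy.mk.injEq] using h

theorem Strategy.prob_cons (σ : M.Strategy) (t : M.Transition) (l : List M.Transition)
    (h : M.History) (hh : h.start = t.next) :
    σ.prob (h.cons t hh) l = (σ.shift t).prob h l := by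
  induction l generalizing h with
  | nil => rfl
  | cons u l ih =>
    have he := σ.shift_act t h hh
    by_cases hu : u.act = σ.act (h.cons t hh)
    · rw [Strategy.prob, Strategy.prob, dif_pos hu, dif_pos (hu.trans he.symm)]
      congr 1
      -- Prepending `t` and appending `u` commute definitionally.
      exact ih (h.snoc u _) hh
    · rw [Strategy.prob, Strategy.prob, dif_neg hu, dif_neg (by rwa [he])]

/-! ### The law of the play, decomposed along the first transition -/

theorem measurable_consWord (t : M.Transition) :
    Measurable (consWord t : (ℕ → M.Transition) → ℕ → M.Transition) := by
  refine measurable_pi_lambda _ fun n => ?_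
  cases n with
  | zero => exact measurable_const
  | succ n => exact measurable_pi_apply n

/-- It suffices to compare cylinders. In a nonempty one, only the summand for the state named by its
first transition can contribute, and only if the action there is the one that `σ` plays. -/
theorem Strategy.playMeasure_eq_sum [Fintype M.State] (σ : M.Strategy) (s : M.State) :
    σ.playMeasure s = ∑ s' : M.State, M.dist (σ.act (.nil s)) s' •
      ((σ.shift ⟨σ.act (.nil s), s'⟩).playMeasure s').map (consWord ⟨σ.act (.nil s), s'⟩) := by
  classical
  refine measure_ext_isPrefix _ _ fun l => ?_
  rw [σ.playMeasure_isPrefix, Measure.finsetSum_apply]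
  simp only [Measure.smul_apply, smul_eq_mul]
  cases l with
  | nil =>
    have h1 : {x : ℕ → M.Transition | IsPrefix [] x} = Set.univ := by
      ext x; simp [IsPrefix]
    have h2 : ∀ s' : M.State, (((σ.shift ⟨σ.act (.nil s), s'⟩).playMeasure s').map
        (consWord ⟨σ.act (.nil s), s'⟩)) Set.univ = 1 := fun s' => by
      rw [Measure.map_apply (measurable_consWord _) MeasurableSet.univ]
      simp
    simp only [h1, h2, mul_one]
    rw [Strategy.prob, ← tsum_fintype (L := .unconditional _), PMF.tsum_coe]
  | cons t l =>
    have hpre : ∀ s' : M.State, (consWord (⟨σ.act (.nil s), s'⟩ : M.Transition)) ⁻¹'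
        {x | IsPrefix (t :: l) x} =
          {x | (⟨σ.act (.nil s), s'⟩ : M.Transition) = t ∧ IsPrefix l x} := by
      intro s'
      ext x
      simp [isPrefix_cons]
    have hm := measurableSet_isPrefix (M := M) (t :: l)
    simp only [Measure.map_apply (measurable_consWord _) hm, hpre]
    by_cases ht : t.act = σ.act (.nil s)
    · rw [Finset.sum_eq_single t.next]
      · obtain ⟨a, s'⟩ := t
        simp only at ht
        subst ht
        simp only [true_and]
        rw [Strategy.playMeasure_isPrefix, Strategy.prob, dif_pos rfl]
        congr 1
        rw [← Strategy.prob_cons _ _ _ (.nil s') rfl]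
        have : (History.nil s).snoc ⟨σ.act (.nil s), s'⟩ (σ.source_act _) =
            (History.nil s').cons ⟨σ.act (.nil s), s'⟩ rfl := by
          simp only [History.snoc, History.cons, History.nil, List.nil_append, History.mk.injEq,
            and_true]
          exact (σ.source_act (.nil s)).symm
        rw [this]
      · intro s' _ hs'
        have : {x : ℕ → M.Transition |
            (⟨σ.act (.nil s), s'⟩ : M.Transition) = t ∧ IsPrefix l x} = ∅ := by
          ext x
          simp only [Set.mem_ofPred_eq, Set.mem_empty_iff_false, iff_false, not_and]
          intro h
          exact absurd (congrArg Transition.next h) hs'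
        rw [this]
        simp
      · simp
    · rw [Strategy.prob, dif_neg ht]
      symm
      refine Finset.sum_eq_zero fun s' _ => ?_
      have : {x : ℕ → M.Transition |
          (⟨σ.act (.nil s), s'⟩ : M.Transition) = t ∧ IsPrefix l x} = ∅ := by
        ext x
        simp only [Set.mem_ofPred_eq, Set.mem_empty_iff_false, iff_false, not_and]
        intro h
        exact absurd (congrArg Transition.act h).symm ht
      rw [this]
      simp

theorem measurable_payoff {φ : (ℕ → A) → ℝ} (hφ : ContinuousPayoff φ) :
    Measurable fun x : ℕ → M.Transition => φ fun n => M.label (x n) := by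
  let _ : TopologicalSpace A := ⊥
  let _ : TopologicalSpace M.Transition := ⊥
  have : DiscreteTopology M.Transition := ⟨rfl⟩
  have : BorelSpace M.Transition := ⟨by
    rw [borel_eq_top_of_discrete]; rfl⟩
  have h : Continuous fun (x : ℕ → M.Transition) n => M.label (x n) := continuous_pi fun n =>
    (continuous_of_discreteTopology (f := M.label)).comp (continuous_apply n)
  exact (Continuous.comp (g := φ) hφ h).measurable

theorem integrable_payoff [Finite A] {φ : (ℕ → A) → ℝ} (hφ : ContinuousPayoff φ)
    (μ : Measure (ℕ → M.Transition)) [IsFiniteMeasure μ] :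
    Integrable (fun x : ℕ → M.Transition => φ fun n => M.label (x n)) μ := by
  obtain ⟨C, -, hC⟩ := hφ.exists_bound
  exact Integrable.of_bound (measurable_payoff hφ).aestronglyMeasurable C
    (Filter.Eventually.of_forall fun x => hC _)

theorem Strategy.abs_value_le {φ : (ℕ → A) → ℝ} {C : ℝ} (hC : ∀ x, |φ x| ≤ C) (σ : M.Strategy)
    (s : M.State) : |σ.value φ s| ≤ C := by
  have := norm_integral_le_of_norm_le_const (μ := σ.playMeasure s)
    (f := fun x : ℕ → M.Transition => φ fun n => M.label (x n))
    (Filter.Eventually.of_forall fun x => hC _)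
  simpa [Strategy.value] using this

/-- The first label is absorbed into the payoff, so this needs only continuity of `φ`. Hence it
serves both the Bellman argument and the analysis of the lottery process. -/
theorem Strategy.value_eq_sum [Finite A] [Fintype M.State] {φ : (ℕ → A) → ℝ}
    (hφ : ContinuousPayoff φ) (σ : M.Strategy) (s : M.State) :
    σ.value φ s = ∑ s' : M.State, (M.dist (σ.act (.nil s)) s').toReal *
      (σ.shift ⟨σ.act (.nil s), s'⟩).value
        (fun x => φ (consWord (M.lab (σ.act (.nil s)) s') x)) s' := by
  rw [Strategy.value, σ.playMeasure_eq_sum s, integral_finsetSum_measure]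
  · refine Finset.sum_congr rfl fun s' _ => ?_
    rw [integral_smul_measure, smul_eq_mul, integral_map (measurable_consWord _).aemeasurable
      (measurable_payoff hφ).aestronglyMeasurable, Strategy.value]
    simp only [comp_consWord (M.label)]
    rfl
  · intro s' _
    have : IsProbabilityMeasure (((σ.shift ⟨σ.act (.nil s), s'⟩).playMeasure s').map
        (consWord ⟨σ.act (.nil s), s'⟩)) :=
      Measure.isProbabilityMeasure_map (measurable_consWord _).aemeasurable
    exact (integrable_payoff hφ _).smul_measure (PMF.apply_ne_top _ _)

theorem sum_dist_toReal [Fintype M.State] (e : M.Act) :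
    ∑ s' : M.State, (M.dist e s').toReal = 1 := by
  rw [← ENNReal.toReal_sum fun s' _ => PMF.apply_ne_top _ _,
    ← tsum_fintype (L := .unconditional _), PMF.tsum_coe, ENNReal.toReal_one]

/-- The positional strategy that plays `b s` in the state `s`. -/
def Strategy.ofPositional (b : M.State → M.Act) (hb : ∀ s, M.source (b s) = s) : M.Strategy where
  act h := b h.target
  source_act _ := hb _

theorem Strategy.positional_ofPositional (b : M.State → M.Act) (hb : ∀ s, M.source (b s) = s) :
    (Strategy.ofPositional b hb).Positional := fun _ _ h => congrArg b h

end MDP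

/-! ### Bellman equations -/

theorem abs_ciSup_sub_ciSup_le {ι : Type*} [Finite ι] [Nonempty ι] (f g : ι → ℝ) (c : ℝ)
    (h : ∀ i, |f i - g i| ≤ c) : |(⨆ i, f i) - ⨆ i, g i| ≤ c := by
  have hf := (Set.finite_range f).bddAbove
  have hg := (Set.finite_range g).bddAbove
  rw [abs_sub_le_iff]
  constructor
  · rw [sub_le_iff_le_add]
    exact ciSup_le fun i => by linarith [(abs_le.1 (h i)).2, le_ciSup hg i]
  · rw [sub_le_iff_le_add]
    exact ciSup_le fun i => by linarith [(abs_le.1 (h i)).1, le_ciSup hf i]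

theorem abs_ciInf_sub_ciInf_le {ι : Type*} [Finite ι] [Nonempty ι] (f g : ι → ℝ) (c : ℝ)
    (h : ∀ i, |f i - g i| ≤ c) : |(⨅ i, f i) - ⨅ i, g i| ≤ c := by
  have hf := (Set.finite_range f).bddBelow
  have hg := (Set.finite_range g).bddBelow
  rw [abs_sub_le_iff]
  constructor
  · rw [sub_le_iff_le_add', ← sub_le_iff_le_add]
    exact le_ciInf fun i => by linarith [(abs_le.1 (h i)).2, ciInf_le hf i]
  · rw [sub_le_iff_le_add', ← sub_le_iff_le_add]
    exact le_ciInf fun i => by linarith [(abs_le.1 (h i)).1, ciInf_le hg i]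

/-- The Bellman equation of a finite game with contracting one-step operators `Q e` has a solution,
and in every position there is a move at which it is attained. -/
theorem exists_bellman {S E : Type*} [Fintype S] [Finite E] (src : E → S)
    (hsrc : Function.Surjective src) (W : Set S) (Q : E → (S → ℝ) → ℝ) {Λ : ℝ} (h0 : 0 ≤ Λ)
    (h1 : Λ < 1) (hQ : ∀ e V V', |Q e V - Q e V'| ≤ Λ * dist V V') :
    ∃ (V : S → ℝ) (best : S → E), (∀ s, src (best s) = s) ∧ (∀ s, Q (best s) V = V s) ∧
      (∀ e, src e ∈ W → Q e V ≤ V (src e)) ∧ ∀ e, src e ∉ W → V (src e) ≤ Q e V := by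
  classical
  have hne : ∀ s, Nonempty {e // src e = s} := fun s => let ⟨e, he⟩ := hsrc s; ⟨⟨e, he⟩⟩
  -- Maximizing on `W` and minimizing elsewhere covers MDPs (`W` everything) and two-player games
  -- with one operator.
  let T : (S → ℝ) → S → ℝ := fun V s =>
    if s ∈ W then ⨆ e : {e // src e = s}, Q e V else ⨅ e : {e // src e = s}, Q e V
  have hT : ContractingWith ⟨Λ, h0⟩ T := by
    refine ⟨by exact_mod_cast h1, LipschitzWith.of_dist_le_mul fun V V' => ?_⟩
    refine (dist_pi_le_iff (mul_nonneg h0 dist_nonneg)).2 fun s => ?_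
    have := hne s
    rw [Real.dist_eq]
    by_cases hs : s ∈ W
    · simp only [T, hs, if_true]
      exact abs_ciSup_sub_ciSup_le _ _ _ fun e => hQ _ _ _
    · simp only [T, hs, if_false]
      exact abs_ciInf_sub_ciInf_le _ _ _ fun e => hQ _ _ _
  have hfix : T (hT.fixedPoint T) = hT.fixedPoint T := hT.fixedPoint_isFixedPt
  set V := hT.fixedPoint T
  have hV : ∀ s, (if s ∈ W then ⨆ e : {e // src e = s}, Q e V
      else ⨅ e : {e // src e = s}, Q e V) = V s := fun s => congrFun hfix s
  have hbest : ∀ s, ∃ e, src e = s ∧ Q e V = V s := by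
    intro s
    have := hne s
    rw [← hV s]
    by_cases hs : s ∈ W
    · obtain ⟨e, he⟩ := exists_eq_ciSup_of_finite (f := fun e : {e // src e = s} => Q e V)
      exact ⟨e, e.2, by rw [if_pos hs]; exact he⟩
    · obtain ⟨e, he⟩ := exists_eq_ciInf_of_finite (f := fun e : {e // src e = s} => Q e V)
      exact ⟨e, e.2, by rw [if_neg hs]; exact he⟩
  choose best hb1 hb2 using hbest
  refine ⟨V, best, hb1, hb2, fun e he => ?_, fun e he => ?_⟩
  · rw [← hV, if_pos he]
    exact le_ciSup (f := fun d : {d // src d = src e} => Q d V) (Set.finite_range _).bddAbove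
      ⟨e, rfl⟩
  · rw [← hV, if_neg he]
    exact ciInf_le (f := fun d : {d // src d = src e} => Q d V) (Set.finite_range _).bddBelow
      ⟨e, rfl⟩

/-! ### Multi-discounted payoffs -/

/-- The recursion that characterizes multi-discounted payoffs among the bounded ones. -/
structure IsMultiDiscounted {A : Type*} (φ : (ℕ → A) → ℝ) (lam w : A → ℝ) (Λ : ℝ) : Prop where
  lam_nonneg : ∀ a, 0 ≤ lam a
  lam_le : ∀ a, lam a ≤ Λ
  nonneg : 0 ≤ Λ
  lt_one : Λ < 1
  apply_consWord : ∀ a x, φ (consWord a x) = w a + lam a * φ x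

/-- Splitting off the first term of the series gives the recursion; finiteness of `A` turns the
bounds λ(a) < 1 into a uniform one. -/
theorem MultiDiscounted.exists_isMultiDiscounted {A : Type*} [Finite A] {φ : (ℕ → A) → ℝ}
    (hφ : MultiDiscounted φ) : ∃ lam w Λ, IsMultiDiscounted φ lam w Λ := by
  obtain ⟨lam, w, hlam, hsum⟩ := hφ
  obtain ⟨Λ, h0, h1, hΛ⟩ : ∃ Λ : ℝ, 0 ≤ Λ ∧ Λ < 1 ∧ ∀ a, lam a ≤ Λ := by
    rcases isEmpty_or_nonempty A with hA | hA
    · exact ⟨0, le_rfl, one_pos, fun a => isEmptyElim a⟩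
    · obtain ⟨a, ha⟩ := Finite.exists_max lam
      exact ⟨lam a, (hlam a).1, (hlam a).2, ha⟩
  refine ⟨lam, w, Λ, fun a => (hlam a).1, hΛ, h0, h1, fun a x => ?_⟩
  have h2 := (hasSum_nat_add_iff' 1).2 (hsum (consWord a x))
  have h3 := (hsum x).mul_left (lam a)
  simp only [Finset.prod_range_succ', consWord_succ, consWord_zero, Finset.sum_range_one,
    Finset.range_zero, Finset.prod_empty, one_mul] at h2
  have h4 := h2.unique (h3.congr_fun ?_)
  · linarith
  · intro n; ring

/-- Unfolding the recursion n times leaves a partial sum of the series and a remainder of size at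
most Λⁿ C, which vanishes because φ is bounded. -/
theorem IsMultiDiscounted.multiDiscounted {A : Type*} {φ : (ℕ → A) → ℝ} {lam w : A → ℝ} {Λ : ℝ}
    (h : IsMultiDiscounted φ lam w Λ) {C : ℝ} (hC : ∀ x, |φ x| ≤ C) : MultiDiscounted φ := by
  refine ⟨lam, w, fun a => ⟨h.lam_nonneg a, (h.lam_le a).trans_lt h.lt_one⟩, fun x => ?_⟩
  have hprod0 : ∀ n, 0 ≤ ∏ i ∈ Finset.range n, lam (x i) := fun n =>
    Finset.prod_nonneg fun i _ => h.lam_nonneg _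
  have hprod : ∀ n, ∏ i ∈ Finset.range n, lam (x i) ≤ Λ ^ n := fun n => by
    simpa using Finset.prod_le_prod (s := Finset.range n) (fun i _ => h.lam_nonneg (x i))
      fun i _ => h.lam_le (x i)
  have hw : ∀ a, |w a| ≤ C + C := fun a => by
    have h1 := h.apply_consWord a x
    have h2 := abs_le.1 (hC (consWord a x))
    have h3 := abs_le.1 (hC x)
    have h4 : |lam a * φ x| ≤ C := by
      rw [abs_mul, abs_of_nonneg (h.lam_nonneg a)]
      exact (mul_le_of_le_one_left (abs_nonneg _) ((h.lam_le a).trans h.lt_one.le)).trans (hC x)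
    have h5 := abs_le.1 h4
    rw [abs_le]
    constructor <;> linarith
  have hpartial : ∀ n, φ x = ∑ k ∈ Finset.range n, (∏ i ∈ Finset.range k, lam (x i)) * w (x k) +
      (∏ i ∈ Finset.range n, lam (x i)) * φ fun k => x (n + k) := by
    intro n
    induction n with
    | zero => simp
    | succ n ih =>
      have h1 := h.apply_consWord (x n) fun k => x (n + 1 + k)
      have h2 : consWord (x n) (fun k => x (n + 1 + k)) = fun k => x (n + k) := by
        funext k
        cases k with
        | zero => rfl
        | succ k => simp [add_assoc, add_comm 1 k]
      rw [h2] at h1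
      rw [Finset.sum_range_succ, Finset.prod_range_succ, ih, h1]
      ring
  have hsummable : Summable fun n => (∏ i ∈ Finset.range n, lam (x i)) * w (x n) := by
    refine Summable.of_norm_bounded
      ((summable_geometric_of_lt_one h.nonneg h.lt_one).mul_right (C + C)) fun n => ?_
    rw [Real.norm_eq_abs, abs_mul, abs_of_nonneg (hprod0 n)]
    exact mul_le_mul (hprod n) (hw _) (abs_nonneg _) (pow_nonneg h.nonneg n)
  rw [hsummable.hasSum_iff_tendsto_nat]
  have hlim : Filter.Tendsto
      (fun n => (∏ i ∈ Finset.range n, lam (x i)) * φ fun k => x (n + k))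
      Filter.atTop (nhds 0) := by
    have h1 := (tendsto_pow_atTop_nhds_zero_of_lt_one h.nonneg h.lt_one).mul_const C
    rw [zero_mul] at h1
    refine squeeze_zero_norm (fun n => ?_) h1
    rw [Real.norm_eq_abs, abs_mul, abs_of_nonneg (hprod0 n)]
    exact mul_le_mul (hprod n) (hC _) (abs_nonneg _) (pow_nonneg h.nonneg n)
  have h2 := (tendsto_const_nhds (x := φ x)).sub hlim
  rw [sub_zero] at h2
  exact h2.congr fun n => by linarith [hpartial n]

namespace MDP

variable {A : Type*} {M : MDP A}

/-- The expectation of `w + lam * V` after one step, where `V` depends on the state reached. -/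
noncomputable def stepValue [Fintype M.State] (lam w : A → ℝ) (e : M.Act) (V : M.State → ℝ) : ℝ :=
  ∑ s' : M.State, (M.dist e s').toReal * (w (M.lab e s') + lam (M.lab e s') * V s')

/-- Monotonicity and discounting in one estimate: it yields the contraction property and also drives
the inductions that compare values with the fixed point. -/
theorem stepValue_le_add [Fintype M.State] {φ : (ℕ → A) → ℝ} {lam w : A → ℝ} {Λ : ℝ}
    (h : IsMultiDiscounted φ lam w Λ) (e : M.Act) {V V' : M.State → ℝ} {d : ℝ} (hd : 0 ≤ d)
    (hV : ∀ s, V s ≤ V' s + d) : stepValue lam w e V ≤ stepValue lam w e V' + Λ * d := by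
  have : ∀ s', (M.dist e s').toReal * (w (M.lab e s') + lam (M.lab e s') * V s') ≤
      (M.dist e s').toReal * (w (M.lab e s') + lam (M.lab e s') * V' s') +
        (M.dist e s').toReal * (Λ * d) := fun s' => by
    rw [← mul_add]
    refine mul_le_mul_of_nonneg_left ?_ ENNReal.toReal_nonneg
    have h1 := mul_le_mul_of_nonneg_left (hV s') (h.lam_nonneg (M.lab e s'))
    have h2 := mul_le_mul_of_nonneg_right (h.lam_le (M.lab e s')) hd
    linarith
  refine (Finset.sum_le_sum fun s' _ => this s').trans_eq ?_
  rw [Finset.sum_add_distrib, ← Finset.sum_mul, sum_dist_toReal, one_mul, stepValue]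

theorem Strategy.value_eq_stepValue [Finite A] [Fintype M.State] {φ : (ℕ → A) → ℝ}
    {lam w : A → ℝ} {Λ : ℝ} (h : IsMultiDiscounted φ lam w Λ) (hφ : ContinuousPayoff φ)
    (σ : M.Strategy) (s : M.State) :
    σ.value φ s = stepValue lam w (σ.act (.nil s))
      fun s' => (σ.shift ⟨σ.act (.nil s), s'⟩).value φ s' := by
  rw [σ.value_eq_sum hφ, stepValue]
  refine Finset.sum_congr rfl fun s' _ => ?_
  congr 1
  simp only [h.apply_consWord, Strategy.value]
  rw [integral_add (integrable_const _) ((integrable_payoff hφ _).const_mul _),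
    integral_const_mul]
  simp

end MDP

theorem nonpos_of_le_geometric {x C Λ : ℝ} (h0 : 0 ≤ Λ) (h1 : Λ < 1)
    (h : ∀ n : ℕ, x ≤ Λ ^ n * C) : x ≤ 0 := by
  have := (tendsto_pow_atTop_nhds_zero_of_lt_one h0 h1).mul_const C
  rw [zero_mul] at this
  exact ge_of_tendsto' this h

theorem IsMultiDiscounted.positionallyDeterminedInMDPs {A : Type*} [Finite A] {φ : (ℕ → A) → ℝ}
    {lam w : A → ℝ} {Λ : ℝ} (h : IsMultiDiscounted φ lam w Λ) (hφ : ContinuousPayoff φ) :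
    PositionallyDeterminedInMDPs φ := by
  intro M
  have := Fintype.ofFinite M.State
  obtain ⟨C, hC0, hC⟩ := hφ.exists_bound
  obtain ⟨V, best, hsrc, hbest, hmax, -⟩ := exists_bellman M.source
    (fun s => let ⟨P, hP⟩ := M.exists_act s; ⟨⟨(s, P), hP⟩, rfl⟩) Set.univ
    (MDP.stepValue lam w) h.nonneg h.lt_one (fun e V V' => by
      have h1 : ∀ V V' : M.State → ℝ, ∀ s, V s ≤ V' s + dist V V' := fun V V' s => by
        linarith [le_abs_self (V s - V' s), Real.dist_eq (V s) (V' s), dist_le_pi_dist V V' s]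
      rw [abs_sub_le_iff]
      constructor
      · linarith [MDP.stepValue_le_add h e dist_nonneg (h1 V V')]
      · rw [dist_comm V V']
        linarith [MDP.stepValue_le_add h e dist_nonneg (h1 V' V)])
  obtain ⟨D, hD⟩ : ∃ D, ∀ s, |V s| ≤ D := by
    obtain ⟨D, hD⟩ := (Set.finite_range fun s => |V s|).bddAbove
    exact ⟨D, fun s => hD ⟨s, rfl⟩⟩
  have hB : 0 ≤ C + |D| := by positivity
  -- The bound is for all strategies at once, since the induction step passes from `σ` to its
  -- shifts.
  have hup : ∀ (n : ℕ) (σ : M.Strategy) s, σ.value φ s ≤ V s + Λ ^ n * (C + |D|) := by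
    intro n
    induction n with
    | zero =>
      intro σ s
      linarith [(abs_le.1 (σ.abs_value_le hC s)).2, (abs_le.1 (hD s)).1, le_abs_self D]
    | succ n ih =>
      intro σ s
      have h1 := MDP.stepValue_le_add h (σ.act (.nil s))
        (mul_nonneg (pow_nonneg h.nonneg n) hB)
        fun s' => ih (σ.shift ⟨σ.act (.nil s), s'⟩) s'
      have h2 := hmax (σ.act (.nil s)) trivial
      rw [σ.source_act] at h2
      have h3 : (MDP.History.nil s).target = s := rfl
      rw [σ.value_eq_stepValue h hφ, pow_succ']
      rw [h3] at h2
      linarith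
  let σ := MDP.Strategy.ofPositional best hsrc
  have hσ : σ.Positional := MDP.Strategy.positional_ofPositional best hsrc
  -- Here `σ` is its own shift, and `best` attains the Bellman equation, so the induction stays with
  -- `σ`.
  have hlow : ∀ (n : ℕ) s, V s ≤ σ.value φ s + Λ ^ n * (C + |D|) := by
    intro n
    induction n with
    | zero =>
      intro s
      linarith [(abs_le.1 (σ.abs_value_le hC s)).1, (abs_le.1 (hD s)).2, le_abs_self D]
    | succ n ih =>
      intro s
      have h1 := MDP.stepValue_le_add h (best s) (mul_nonneg (pow_nonneg h.nonneg n) hB) ih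
      rw [hbest] at h1
      have h2 := σ.value_eq_stepValue h hφ s
      simp only [hσ.shift_eq] at h2
      rw [h2, pow_succ', mul_assoc]
      exact h1
  refine ⟨σ, hσ, fun σ' s => ?_⟩
  have h1 := nonpos_of_le_geometric (C := C + |D|) (x := σ'.value φ s - V s) h.nonneg
    h.lt_one fun n => by linarith [hup n σ' s]
  have h2 := nonpos_of_le_geometric (C := C + |D|) (x := V s - σ.value φ s) h.nonneg
    h.lt_one fun n => by linarith [hlow n s]
  linarith

/-! ### The plays that have positive probability -/

theorem IsWalk.src_of_append {V E : Type*} {src tgt : E → V} {s : V} {l : List E} {e : E}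
    (h : IsWalk src tgt s (l ++ [e])) : src e = walkEnd tgt s l := by
  induction l generalizing s with
  | nil => exact h.1
  | cons d l ih => exact ih h.2

theorem walkEnd_append_singleton {V E : Type*} (tgt : E → V) (s : V) (l : List E) (e : E) :
    walkEnd tgt s (l ++ [e]) = tgt e := by
  induction l generalizing s with
  | nil => rfl
  | cons d l ih => exact ih _

namespace MDP

variable {A : Type*} {M : MDP A}

theorem Strategy.isWalk_of_prob_ne_zero (σ : M.Strategy) (h : M.History) (l : List M.Transition)
    (hl : σ.prob h l ≠ 0) :
    IsWalk (fun t : M.Transition => M.source t.act) Transition.next h.target l ∧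
      ∀ t ∈ l, M.dist t.act t.next ≠ 0 := by
  induction l generalizing h with
  | nil => exact ⟨trivial, by simp⟩
  | cons t l ih =>
    by_cases ht : t.act = σ.act h
    · rw [Strategy.prob, dif_pos ht] at hl
      have h1 := ih _ (right_ne_zero_of_mul hl)
      have h2 : (h.snoc t ((congrArg M.source ht).trans (σ.source_act h))).target = t.next :=
        walkEnd_append_singleton _ _ _ _
      rw [h2] at h1
      refine ⟨⟨(congrArg M.source ht).trans (σ.source_act h), h1.1⟩, ?_⟩
      rintro u (_ | ⟨_, hu⟩)
      · exact left_ne_zero_of_mul hl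
      · exact h1.2 u hu
    · rw [Strategy.prob, dif_neg ht] at hl
      exact absurd rfl hl

/-- There are countably many finite sequences of transitions, so almost surely no prefix of the play
has probability zero. -/
theorem Strategy.ae_walk (σ : M.Strategy) (s : M.State) :
    ∀ᵐ x ∂σ.playMeasure s, M.source (x 0).act = s ∧
      (∀ n, M.source (x (n + 1)).act = (x n).next) ∧
      ∀ n, M.dist (x n).act (x n).next ≠ 0 := by
  have h1 : ∀ᵐ x ∂σ.playMeasure s, ∀ l, IsPrefix l x → σ.prob (.nil s) l ≠ 0 := by
    rw [ae_all_iff]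
    intro l
    by_cases hl : σ.prob (.nil s) l = 0
    · rw [← σ.playMeasure_isPrefix] at hl
      filter_upwards [measure_eq_zero_iff_ae_notMem.1 hl] with x hx hx'
      exact absurd hx' hx
    · exact Filter.Eventually.of_forall fun x _ => hl
  filter_upwards [h1] with x hx
  have h2 := fun n => σ.isWalk_of_prob_ne_zero _ _
    (hx ((List.range n).map x) fun i hi => by simp)
  have h3 : ∀ n, M.source (x n).act = walkEnd Transition.next s ((List.range n).map x) := by
    intro n
    have h4 := (h2 (n + 1)).1
    rw [List.range_succ, List.map_append] at h4
    exact h4.src_of_append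
  refine ⟨h3 0, fun n => ?_, fun n => (h2 (n + 1)).2 _ ?_⟩
  · rw [h3, List.range_succ, List.map_append]
    exact walkEnd_append_singleton _ _ _ _
  · exact List.mem_map_of_mem (by simp)

end MDP

theorem PMF.sum_map_toReal_mul {ι S : Type*} [Fintype ι] [Fintype S] (p : PMF ι) (f : ι → S)
    (F : S → ℝ) : ∑ s, (p.map f s).toReal * F s = ∑ i, (p i).toReal * F (f i) := by
  let _ : MeasurableSpace ι := ⊤
  let _ : MeasurableSpace S := ⊤
  have h1 := PMF.integral_eq_sum (p.map f) F
  have h2 := PMF.integral_eq_sum p (F ∘ f)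
  have hf : Measurable f := fun _ _ => trivial
  have hF : Measurable F := fun _ _ => trivial
  rw [← PMF.toMeasure_map f p hf, integral_map hf.aemeasurable hF.aestronglyMeasurable] at h1
  simp only [smul_eq_mul, Function.comp_apply] at h1 h2
  rw [← h1, ← h2]

/-! ### A decision between two lotteries over words -/

/-- The states of a decision process in which, after a first step, one chooses between two
lotteries over words indexed by `ι`; a word becomes constant after `N + 1` letters. -/
inductive LotteryState (ι : Type) (N : ℕ) : Type
  | pre
  | choice
  | tail (i : ι) (k : Fin (N + 1))

namespace LotteryState

variable {ι : Type} {N : ℕ} {A : Type*}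

instance [Finite ι] : Finite (LotteryState ι N) := by
  refine Finite.of_surjective (fun x : Option (Option (ι × Fin (N + 1))) => match x with
    | none => pre
    | some none => choice
    | some (some (i, k)) => tail i k) fun s => ?_
  cases s with
  | pre => exact ⟨none, rfl⟩
  | choice => exact ⟨some none, rfl⟩
  | tail i k => exact ⟨some (some (i, k)), rfl⟩

noncomputable def dist (p : PMF ι) : LotteryState ι N → PMF (LotteryState ι N)
  | pre => PMF.pure choice
  | choice => p.map fun i => tail i 0
  | tail i k => PMF.pure (tail i ⟨min (k + 1) N, by omega⟩)

def label (α : ι → ℕ → A) (a : A) : LotteryState ι N → LotteryState ι N → A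
  | choice, tail i _ => α i 0
  | tail i k, _ => α i (k + 1)
  | _, _ => a

end LotteryState

section Lottery

variable {ι : Type} [Finite ι] {A : Type*} (N : ℕ) (P : Bool → PMF ι) (α : ι → ℕ → A) (a : A)

/-- The process in which, after a step labeled by `a`, one chooses between the lotteries `P true`
and `P false` over the words `α i` (made constant after `N + 1` letters). -/
noncomputable abbrev lotteryMDP : MDP A where
  State := LotteryState ι N
  Act := (Set.finite_range
    fun x : Bool × LotteryState ι N => (x.2, LotteryState.dist (P x.1) x.2)).toFinset
  lab e s' := LotteryState.label α a e.1.1 s'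
  exists_act s := ⟨LotteryState.dist (P true) s, by simp⟩

theorem lotteryMDP_dist (e : (lotteryMDP N P α a).Act) : ∃ b, (lotteryMDP N P α a).dist e =
    LotteryState.dist (P b) ((lotteryMDP N P α a).source e) := by
  have h := (Set.Finite.mem_toFinset _).1 e.2
  obtain ⟨⟨b, s⟩, hb⟩ := h
  refine ⟨b, ?_⟩
  rw [MDP.dist, MDP.source, ← hb]

/-- The action of `lotteryMDP` that is played in the state `s` if `P b` is preferred. -/
noncomputable def lotteryAct (b : Bool) (s : LotteryState ι N) : (lotteryMDP N P α a).Act :=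
  ⟨(s, LotteryState.dist (P b) s), (Set.Finite.mem_toFinset _).2 ⟨(b, s), rfl⟩⟩

/-- The positional strategy that chooses `P b`. -/
noncomputable def lotteryStrategy (b : Bool) : (lotteryMDP N P α a).Strategy :=
  MDP.Strategy.ofPositional (lotteryAct N P α a b) fun _ => rfl

variable {N P α a}

/-- The tail is deterministic under every strategy, so almost every play has the same labels. The
index starts at 1 because the letter `α i 0` is emitted on leaving `choice`. -/
theorem value_tail (φ : (ℕ → A) → ℝ) (σ : (lotteryMDP N P α a).Strategy) (i : ι) :
    σ.value φ (LotteryState.tail i 0) = φ fun n => α i (min n N + 1) := by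
  have h : ∀ᵐ x ∂σ.playMeasure (LotteryState.tail i 0),
      (φ fun n => (lotteryMDP N P α a).label (x n)) = φ fun n => α i (min n N + 1) := by
    filter_upwards [σ.ae_walk _] with x hx
    obtain ⟨h0, h1, h2⟩ := hx
    have h3 : ∀ n, (lotteryMDP N P α a).source (x n).act =
        LotteryState.tail i ⟨min n N, by omega⟩ := by
      intro n
      induction n with
      | zero => rw [h0]; simp
      | succ n ih =>
        have h4 := h2 n
        obtain ⟨b, hb⟩ := lotteryMDP_dist N P α a (x n).act
        rw [hb, ih] at h4
        have h5 := (PMF.mem_support_iff _ _).2 h4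
        simp only [LotteryState.dist, PMF.support_pure, Set.mem_singleton_iff] at h5
        rw [h1, h5]
        congr 2
        omega
    congr 1
    funext n
    have h4 : (lotteryMDP N P α a).label (x n) =
      LotteryState.label α a ((lotteryMDP N P α a).source (x n).act) (x n).next := rfl
    rw [h4, h3]
    rfl
  rw [MDP.Strategy.value, integral_congr_ae h]
  simp

/-- The word `x`, made constant after `N + 1` letters. -/
def truncWord (N : ℕ) (x : ℕ → A) (n : ℕ) : A := x (min n (N + 1))

theorem consWord_tail (N : ℕ) (x : ℕ → A) :
    consWord (x 0) (fun n => x (min n N + 1)) = truncWord N x := by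
  funext n
  cases n with
  | zero => simp [truncWord]
  | succ n => simp [truncWord, Nat.add_min_add_right]

theorem value_choice [Finite A] [Fintype ι] {φ : (ℕ → A) → ℝ} (hφ : ContinuousPayoff φ)
    (σ : (lotteryMDP N P α a).Strategy) (b : Bool)
    (hb : (lotteryMDP N P α a).dist (σ.act (.nil LotteryState.choice)) =
      LotteryState.dist (P b) LotteryState.choice) :
    σ.value φ LotteryState.choice = ∑ i, (P b i).toReal * φ (truncWord N (α i)) := by
  let _ : Fintype (lotteryMDP N P α a).State := Fintype.ofFinite _
  let _ : Fintype (LotteryState ι N) := Fintype.ofFinite _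
  rw [σ.value_eq_sum hφ, hb]
  refine (PMF.sum_map_toReal_mul (P b) _ _).trans (Finset.sum_congr rfl fun i _ => ?_)
  congr 1
  refine (value_tail _ _ i).trans (congrArg φ ?_)
  rw [← consWord_tail]
  congr 1
  have h1 : (lotteryMDP N P α a).lab (σ.act (.nil LotteryState.choice)) =
    LotteryState.label α a ((lotteryMDP N P α a).source (σ.act (.nil LotteryState.choice))) := rfl
  rw [h1, σ.source_act]
  rfl

theorem value_pre [Finite A] [Fintype ι] {φ : (ℕ → A) → ℝ} (hφ : ContinuousPayoff φ)
    (σ : (lotteryMDP N P α a).Strategy) (hσ : σ.Positional) (b : Bool)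
    (hb : (lotteryMDP N P α a).dist (σ.act (.nil LotteryState.choice)) =
      LotteryState.dist (P b) LotteryState.choice) :
    σ.value φ LotteryState.pre =
      ∑ i, (P b i).toReal * φ (consWord a (truncWord N (α i))) := by
  classical
  let _ : Fintype (lotteryMDP N P α a).State := Fintype.ofFinite _
  have h1 : (lotteryMDP N P α a).source (σ.act (.nil LotteryState.pre)) = LotteryState.pre :=
    σ.source_act _
  have h2 : (lotteryMDP N P α a).dist (σ.act (.nil LotteryState.pre)) =
      PMF.pure LotteryState.choice := by
    obtain ⟨c, hc⟩ := lotteryMDP_dist N P α a (σ.act (.nil LotteryState.pre))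
    rw [hc, h1]
    rfl
  have h3 : (lotteryMDP N P α a).lab (σ.act (.nil LotteryState.pre)) LotteryState.choice = a := by
    have h4 : (lotteryMDP N P α a).lab (σ.act (.nil LotteryState.pre)) =
      LotteryState.label α a ((lotteryMDP N P α a).source (σ.act (.nil LotteryState.pre))) := rfl
    rw [h4, h1]
    rfl
  rw [σ.value_eq_sum hφ, h2, Finset.sum_eq_single (LotteryState.choice : LotteryState ι N)]
  -- Positionality enters here: after the letter `a`, the strategy takes the same decision at
  -- `choice` as when it starts there.
  · rw [PMF.pure_apply, if_pos rfl, ENNReal.toReal_one, one_mul, hσ.shift_eq, h3]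
    exact value_choice (hφ.comp_consWord a) σ b hb
  · intro s _ hs
    rw [PMF.pure_apply, if_neg hs]
    simp
  · intro h
    exact absurd (Finset.mem_univ _) h

end Lottery

/-- A strict preference between two lotteries over eventually constant words is not reversed by a
common first letter. -/
theorem PositionallyDeterminedInMDPs.lottery_le {ι : Type} [Fintype ι] {A : Type*} [Finite A]
    {φ : (ℕ → A) → ℝ} (hφ : ContinuousPayoff φ) (hdet : PositionallyDeterminedInMDPs φ) (N : ℕ)
    (p q : PMF ι) (α : ι → ℕ → A) (a : A)
    (h : ∑ i, (q i).toReal * φ (truncWord N (α i)) <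
      ∑ i, (p i).toReal * φ (truncWord N (α i))) :
    ∑ i, (q i).toReal * φ (consWord a (truncWord N (α i))) ≤
      ∑ i, (p i).toReal * φ (consWord a (truncWord N (α i))) := by
  let P : Bool → PMF ι := fun b => cond b p q
  obtain ⟨σ, hσ, hopt⟩ := hdet (lotteryMDP N P α a)
  obtain ⟨b, hb⟩ := lotteryMDP_dist N P α a (σ.act (.nil LotteryState.choice))
  rw [σ.source_act] at hb
  have hpos : ∀ c, (lotteryStrategy N P α a c).Positional := fun c =>
    MDP.Strategy.positional_ofPositional _ _
  have h1 := value_choice hφ σ b hb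
  have h2 := value_pre hφ σ hσ b hb
  have h3 := value_choice hφ (lotteryStrategy N P α a true) true rfl
  have h4 := value_pre hφ (lotteryStrategy N P α a false) (hpos false) false rfl
  -- Optimality from `choice` rules out the worse lottery `q`; having chosen `p`, optimality from
  -- `pre` compares the two after the letter `a`.
  cases b with
  | true =>
    have h5 := hopt (lotteryStrategy N P α a false) LotteryState.pre
    rw [h4, h2] at h5
    exact h5
  | false =>
    have h5 := hopt (lotteryStrategy N P α a true) LotteryState.choice
    rw [h3, h1] at h5
    exact absurd h (not_lt.2 h5)

theorem tendsto_truncWord {A : Type*} {φ : (ℕ → A) → ℝ} (hφ : ContinuousPayoff φ) (x : ℕ → A) :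
    Filter.Tendsto (fun N => φ (truncWord N x)) Filter.atTop (nhds (φ x)) := by
  let _ : TopologicalSpace A := ⊥
  refine (Continuous.tendsto (f := φ) hφ x).comp (tendsto_pi_nhds.2 fun n => ?_)
  refine tendsto_const_nhds.congr' ?_
  filter_upwards [Filter.eventually_ge_atTop n] with N hN
  rw [truncWord, min_eq_left (by omega)]

/-- The strict hypothesis survives truncation of the words for large `N`, and the weak conclusion
survives the limit. -/
theorem PositionallyDeterminedInMDPs.lottery_le_of_lt {ι : Type} [Fintype ι] {A : Type*} [Finite A]
    {φ : (ℕ → A) → ℝ} (hφ : ContinuousPayoff φ) (hdet : PositionallyDeterminedInMDPs φ)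
    (p q : PMF ι) (α : ι → ℕ → A) (a : A)
    (h : ∑ i, (q i).toReal * φ (α i) < ∑ i, (p i).toReal * φ (α i)) :
    ∑ i, (q i).toReal * φ (consWord a (α i)) ≤ ∑ i, (p i).toReal * φ (consWord a (α i)) := by
  have hlim : ∀ (r : PMF ι) {ψ : (ℕ → A) → ℝ}, ContinuousPayoff ψ → Filter.Tendsto
      (fun N => ∑ i, (r i).toReal * ψ (truncWord N (α i))) Filter.atTop
      (nhds (∑ i, (r i).toReal * ψ (α i))) := fun r ψ hψ =>
    tendsto_finsetSum _ fun i _ => (tendsto_truncWord hψ (α i)).const_mul _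
  refine le_of_tendsto_of_tendsto (hlim q (hφ.comp_consWord a)) (hlim p (hφ.comp_consWord a)) ?_
  filter_upwards [(hlim q hφ).eventually_lt (hlim p hφ) h] with N hN
  exact hdet.lottery_le hφ N p q α a hN

/-! ### Affine uniqueness of expected utility, and the recursion -/

theorem PMF.exists_toReal_eq {ι : Type*} [Fintype ι] (r : ι → ℝ) (h0 : ∀ i, 0 ≤ r i)
    (h1 : ∑ i, r i = 1) : ∃ p : PMF ι, ∀ i, (p i).toReal = r i := by
  refine ⟨PMF.ofFintype (fun i => ENNReal.ofReal (r i)) ?_, fun i => ?_⟩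
  · rw [← ENNReal.ofReal_sum_of_nonneg fun i _ => h0 i, h1, ENNReal.ofReal_one]
  · rw [PMF.ofFintype_apply, ENNReal.toReal_ofReal (h0 i)]

/-- The difference of two lotteries is, up to a factor, an arbitrary vector of sum zero. -/
theorem nonneg_of_forall_lottery_le {ι : Type*} [Fintype ι] [Nonempty ι] (f g : ι → ℝ)
    (h : ∀ p q : PMF ι, ∑ i, (q i).toReal * f i < ∑ i, (p i).toReal * f i →
      ∑ i, (q i).toReal * g i ≤ ∑ i, (p i).toReal * g i)
    (m : ι → ℝ) (hm : ∑ i, m i = 0) (hf : 0 < ∑ i, m i * f i) : 0 ≤ ∑ i, m i * g i := by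
  have hc : (0 : ℝ) < Fintype.card ι := by exact_mod_cast Fintype.card_pos
  set u : ℝ := (Fintype.card ι : ℝ)⁻¹
  have hu : 0 < u := inv_pos.2 hc
  have hsum : ∑ _i : ι, u = 1 := by
    rw [Finset.sum_const, Finset.card_univ, nsmul_eq_mul]
    exact mul_inv_cancel₀ hc.ne'
  obtain ⟨B, hB⟩ := (Set.finite_range fun i => |m i|).bddAbove
  have hB' : ∀ i, |m i| ≤ |B| + 1 := fun i => by linarith [hB ⟨i, rfl⟩, le_abs_self B]
  have hBpos : 0 < |B| + 1 := by positivity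
  -- With `q` uniform of weight `u`, this keeps `u + ε * m i` nonnegative, so that it is the weight
  -- of a lottery `p`.
  set ε : ℝ := u / (|B| + 1)
  have hε : 0 < ε := div_pos hu hBpos
  have hεB : ε * (|B| + 1) = u := div_mul_cancel₀ _ hBpos.ne'
  obtain ⟨q, hq⟩ := PMF.exists_toReal_eq (fun _ : ι => u) (fun _ => hu.le) hsum
  obtain ⟨p, hp⟩ := PMF.exists_toReal_eq (fun i => u + ε * m i) (fun i => by
      have h1 := mul_le_mul_of_nonneg_left (hB' i) hε.le
      have h2 := mul_le_mul_of_nonneg_left (neg_abs_le (m i)) hε.le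
      linarith)
    (by rw [Finset.sum_add_distrib, ← Finset.mul_sum, hm, hsum]; ring)
  have hexp : ∀ k : ι → ℝ, ∑ i, (u + ε * m i) * k i = ∑ i, u * k i + ε * ∑ i, m i * k i := by
    intro k
    rw [Finset.mul_sum, ← Finset.sum_add_distrib]
    exact Finset.sum_congr rfl fun i _ => by ring
  have h1 := h p q
  simp only [hp, hq, hexp] at h1
  have h2 := h1 (by linarith [mul_pos hε hf])
  exact nonneg_of_mul_nonneg_right (by linarith : 0 ≤ ε * ∑ i, m i * g i) hε

/-- Against the reference words `x₀` and `x₁`, every word `x` gives three values of φ and three of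
g. A sum-zero vector that annihilates the former also annihilates the latter, which places g(x) on
the line through the two reference points. -/
theorem PositionallyDeterminedInMDPs.exists_affine {A : Type*} [Finite A] {φ : (ℕ → A) → ℝ}
    (hφ : ContinuousPayoff φ) (hdet : PositionallyDeterminedInMDPs φ) {x₀ x₁ : ℕ → A}
    (hx : φ x₀ < φ x₁) (a : A) :
    ∃ lam w, 0 ≤ lam ∧ ∀ x, φ (consWord a x) = w + lam * φ x := by
  set g : (ℕ → A) → ℝ := fun x => φ (consWord a x) with hg
  have key : ∀ x m₀ m₁ m₂, m₀ + m₁ + m₂ = 0 → 0 < m₀ * φ x₀ + m₁ * φ x₁ + m₂ * φ x →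
      0 ≤ m₀ * g x₀ + m₁ * g x₁ + m₂ * g x := by
    intro x m₀ m₁ m₂ hm hpos
    have := nonneg_of_forall_lottery_le (fun i : Fin 3 => φ (![x₀, x₁, x] i))
      (fun i => g (![x₀, x₁, x] i))
      (fun p q h => hdet.lottery_le_of_lt hφ p q ![x₀, x₁, x] a h) ![m₀, m₁, m₂]
    simp only [Fin.sum_univ_three, Matrix.cons_val] at this
    exact this hm hpos
  have hd : 0 < φ x₁ - φ x₀ := sub_pos.2 hx
  have hmono : 0 ≤ g x₁ - g x₀ := by
    linarith [key x₀ (-1) 1 0 (by norm_num) (by linarith)]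
  have heq : ∀ x m₀ m₁ m₂, m₀ + m₁ + m₂ = 0 → m₀ * φ x₀ + m₁ * φ x₁ + m₂ * φ x = 0 →
      0 ≤ m₀ * g x₀ + m₁ * g x₁ + m₂ * g x := by
    intro x m₀ m₁ m₂ hm hzero
    refine le_of_forall_pos_le_add fun ε hε => ?_
    -- Moving this much weight from `x₀` to `x₁` makes the φ-sum positive and changes the g-sum by
    -- at most `ε`. The `+ 1` covers the case `g x₁ = g x₀`.
    have hδ : 0 < ε / (g x₁ - g x₀ + 1) := by positivity
    have h1 := key x (m₀ - ε / (g x₁ - g x₀ + 1)) (m₁ + ε / (g x₁ - g x₀ + 1)) m₂ (by linarith)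
      (by nlinarith [mul_pos hδ hd])
    have h2 : ε / (g x₁ - g x₀ + 1) * (g x₁ - g x₀ + 1) = ε :=
      div_mul_cancel₀ _ (by linarith)
    nlinarith
  refine ⟨(g x₁ - g x₀) / (φ x₁ - φ x₀), g x₀ - (g x₁ - g x₀) / (φ x₁ - φ x₀) * φ x₀,
    by positivity, fun x => ?_⟩
  -- The vector that annihilates constants and φ on the three words; its negative gives the reverse
  -- inequality.
  have h1 := heq x (φ x₁ - φ x) (φ x - φ x₀) (φ x₀ - φ x₁) (by ring) (by ring)
  have h2 := heq x (φ x - φ x₁) (φ x₀ - φ x) (φ x₁ - φ x₀) (by ring) (by ring)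
  have h3 : (g x - g x₀) * (φ x₁ - φ x₀) = (g x₁ - g x₀) * (φ x - φ x₀) := by nlinarith
  change g x = _
  field_simp
  linarith

/-- With slope at least 1, prefixing `a` repeatedly would never shrink the gap φ(x₁) − φ(x₀), yet
both words converge to aaa…. -/
theorem lt_one_of_consWord_eq {A : Type*} {φ : (ℕ → A) → ℝ} (hφ : ContinuousPayoff φ) {x₀ x₁ : ℕ → A}
    (hx : φ x₀ < φ x₁) {a : A} {lam w : ℝ} (hlam : ∀ x, φ (consWord a x) = w + lam * φ x) :
    lam < 1 := by
  by_contra! hge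
  have h1 : ∀ n, φ x₁ - φ x₀ ≤ φ ((consWord a)^[n] x₁) - φ ((consWord a)^[n] x₀) := by
    intro n
    induction n with
    | zero => exact le_rfl
    | succ n ih =>
      rw [Function.iterate_succ_apply', Function.iterate_succ_apply', hlam, hlam]
      nlinarith
  have h2 : ∀ x, Filter.Tendsto (fun n => φ ((consWord a)^[n] x)) Filter.atTop
      (nhds (φ fun _ => a)) := by
    intro x
    let _ : TopologicalSpace A := ⊥
    refine (Continuous.tendsto (f := φ) hφ _).comp (tendsto_pi_nhds.2 fun k => ?_)
    refine tendsto_const_nhds.congr' ?_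
    have h3 : ∀ n k, k < n → (consWord a)^[n] x k = a := by
      intro n
      induction n with
      | zero => intro k hk; omega
      | succ n ih =>
        intro k hk
        rw [Function.iterate_succ_apply']
        cases k with
        | zero => rfl
        | succ k => exact ih k (by omega)
    filter_upwards [Filter.eventually_gt_atTop k] with n hn
    exact (h3 n k hn).symm
  have h3 := ge_of_tendsto' ((h2 x₁).sub (h2 x₀)) h1
  linarith

theorem PositionallyDeterminedInMDPs.multiDiscounted {A : Type*} [Finite A] {φ : (ℕ → A) → ℝ}
    (hφ : ContinuousPayoff φ) (hdet : PositionallyDeterminedInMDPs φ) : MultiDiscounted φ := by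
  obtain ⟨C, -, hC⟩ := hφ.exists_bound
  by_cases hconst : ∃ x₀ x₁, φ x₀ < φ x₁
  · obtain ⟨x₀, x₁, hx⟩ := hconst
    choose lam w hlam hw using hdet.exists_affine hφ hx
    have hlt : ∀ a, lam a < 1 := fun a => lt_one_of_consWord_eq hφ hx (hw a)
    have : Nonempty A := ⟨x₀ 0⟩
    obtain ⟨a, ha⟩ := Finite.exists_max lam
    exact IsMultiDiscounted.multiDiscounted ⟨hlam, ha, hlam a, hlt a, hw⟩ hC
  · push Not at hconst
    -- A constant payoff is multi-discounted with all discount factors zero.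
    refine IsMultiDiscounted.multiDiscounted (lam := 0) (Λ := 0) (w := fun a => φ fun _ => a)
      ⟨fun _ => le_rfl, fun _ => le_rfl, le_rfl, one_pos, fun a x => ?_⟩ hC
    have h := le_antisymm (hconst (fun _ => a) (consWord a x)) (hconst (consWord a x) fun _ => a)
    simp [h]

/-! ### Games with multi-discounted payoffs -/

theorem IsMultiDiscounted.neg {A : Type*} {φ : (ℕ → A) → ℝ} {lam w : A → ℝ} {Λ : ℝ}
    (h : IsMultiDiscounted φ lam w Λ) :
    IsMultiDiscounted (fun x => -φ x) lam (fun a => -w a) Λ :=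
  ⟨h.lam_nonneg, h.lam_le, h.nonneg, h.lt_one, fun a x => by rw [h.apply_consWord]; ring⟩

/-- A bounded potential which increases along a play at most as the payoff prescribes is a lower
bound for the payoff of the play. -/
theorem IsMultiDiscounted.le_of_le_step {A : Type*} {φ : (ℕ → A) → ℝ} {lam w : A → ℝ} {Λ : ℝ}
    (h : IsMultiDiscounted φ lam w Λ) {B : ℝ} (v : ℕ → ℝ) (x : ℕ → A)
    (hB : ∀ n y, v n - φ y ≤ B) (hv : ∀ n, v n ≤ w (x n) + lam (x n) * v (n + 1)) :
    v 0 ≤ φ x := by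
  -- The gap at position `n` is at most Λ times a bound for the gap at `n + 1`, so the induction on
  -- `m` needs all positions.
  have key : ∀ m n, v n - φ (fun k => x (n + k)) ≤ Λ ^ m * |B| := by
    intro m
    induction m with
    | zero => intro n; linarith [hB n fun k => x (n + k), le_abs_self B]
    | succ m ih =>
      intro n
      have h1 : (fun k => x (n + k)) = consWord (x n) fun k => x (n + 1 + k) := by
        funext k
        cases k with
        | zero => rfl
        | succ k => simp [add_assoc, add_comm 1 k]
      rw [h1, h.apply_consWord, pow_succ', mul_assoc]
      have h2 := mul_le_mul_of_nonneg_left (ih (n + 1)) (h.lam_nonneg (x n))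
      have h3 := mul_le_mul_of_nonneg_right (h.lam_le (x n))
        (mul_nonneg (pow_nonneg h.nonneg m) (abs_nonneg B))
      linarith [hv n]
  have h1 := nonpos_of_le_geometric h.nonneg h.lt_one fun m => key m 0
  simp only [zero_add] at h1
  linarith

/-! ### Plays, weak duality and guarantees in game graphs -/

namespace GameGraph

variable {A : Type*} {G : GameGraph A}

/-- A finite path extended by one edge. -/
def Path.snoc (p : G.Path) (e : G.E) (he : source e = p.last) : G.Path :=
  ⟨p.start, p.edges ++ [e], p.isWalk.snoc e he⟩

theorem Path.last_snoc (p : G.Path) (e : G.E) (he : source e = p.last) :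
    (p.snoc e he).last = target e :=
  walkEnd_append_singleton _ _ _ _

theorem isPrefix_append_singleton {α : Type*} {l : List α} {x : ℕ → α} (h : IsPrefix l x) {a : α}
    (ha : x l.length = a) : IsPrefix (l ++ [a]) x := by
  intro i hi
  rw [List.getElem_append]
  split_ifs with h1
  · exact h i h1
  · have : i = l.length := by
      rw [List.length_append, List.length_singleton] at hi
      omega
    simp [this, ha]

theorem exists_prefix_path {P : ℕ → G.E} (hP : ∀ n, source (P (n + 1)) = target (P n)) (n : ℕ) :
    ∃ p : G.Path, p.start = source (P 0) ∧ IsPrefix p.edges P ∧ p.edges.length = n ∧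
      p.last = source (P n) := by
  induction n with
  | zero => exact ⟨⟨source (P 0), [], trivial⟩, rfl, fun i hi => absurd hi (by simp), rfl, rfl⟩
  | succ n ih =>
    obtain ⟨p, h1, h2, h3, h4⟩ := ih
    refine ⟨p.snoc (P n) h4.symm, h1, isPrefix_append_singleton h2 (by rw [h3]), ?_, ?_⟩
    · simp [Path.snoc, h3]
    · rw [Path.last_snoc, hP]

/-- The positional strategy that plays `b s` in the node `s`. -/
def Strategy.ofPositional (W : Set G.V) (b : G.V → G.E) (hb : ∀ s, source (b s) = s) :
    G.Strategy W where
  move p _ := b p.last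
  source_move _ _ := hb _

theorem Strategy.positional_ofPositional (W : Set G.V) (b : G.V → G.E)
    (hb : ∀ s, source (b s) = s) : (Strategy.ofPositional W b hb).Positional :=
  fun _ _ _ _ h => congrArg b h

theorem Strategy.eq_of_mem_cons_ofPositional {W : Set G.V} {b : G.V → G.E}
    {hb : ∀ s, source (b s) = s} {s : G.V} {P : ℕ → G.E}
    (hP : P ∈ (Strategy.ofPositional W b hb).Cons s) (n : ℕ) (hn : source (P n) ∈ W) :
    P n = b (source (P n)) := by
  obtain ⟨p, h1, h2, h3, h4⟩ := exists_prefix_path hP.2.1 n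
  have h5 := hP.2.2 p (by rwa [h4]) (h1.trans hP.1) h2
  rw [h3] at h5
  rw [h5]
  change b p.last = b (source (b p.last))
  rw [hb]

section Play

open Classical in
/-- The edge chosen after the path `p` by the player whose turn it is. -/
noncomputable def nextEdge (σ : G.Strategy G.VMax) (τ : G.Strategy G.VMin) (p : G.Path) : G.E :=
  if hp : p.last ∈ G.VMax then σ.move p hp else τ.move p hp

theorem source_nextEdge (σ : G.Strategy G.VMax) (τ : G.Strategy G.VMin) (p : G.Path) :
    source (nextEdge σ τ p) = p.last := by
  unfold nextEdge
  split_ifs with hp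
  · exact σ.source_move p hp
  · exact τ.source_move p hp

/-- The finite prefixes of the play of `σ` against `τ` from `s`. -/
noncomputable def playPath (σ : G.Strategy G.VMax) (τ : G.Strategy G.VMin) (s : G.V) : ℕ → G.Path
  | 0 => ⟨s, [], trivial⟩
  | n + 1 => (playPath σ τ s n).snoc (nextEdge σ τ (playPath σ τ s n)) (source_nextEdge _ _ _)

/-- The witness is the play of the two strategies against each other. -/
theorem exists_mem_cons (σ : G.Strategy G.VMax) (τ : G.Strategy G.VMin) (s : G.V) :
    ∃ P : ℕ → G.E, P ∈ σ.Cons s ∧ P ∈ τ.Cons s := by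
  let P : ℕ → G.E := fun n => nextEdge σ τ (playPath σ τ s n)
  have hlen : ∀ n, (playPath σ τ s n).edges.length = n := by
    intro n
    induction n with
    | zero => rfl
    | succ n ih => simp [playPath, Path.snoc, ih]
  have hstart : ∀ n, (playPath σ τ s n).start = s := by
    intro n
    induction n with
    | zero => rfl
    | succ n ih => exact ih
  have hpre : ∀ n, IsPrefix (playPath σ τ s n).edges P := by
    intro n
    induction n with
    | zero => exact fun i hi => absurd hi (by simp [playPath])
    | succ n ih => exact isPrefix_append_singleton ih (by rw [hlen])
  -- Consistency quantifies over all finite paths, but a prefix of the play is determined by its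
  -- length.
  have huniq : ∀ p : G.Path, p.start = s → IsPrefix p.edges P →
      p = playPath σ τ s p.edges.length := by
    intro p hs hp
    have h1 : p.edges = (playPath σ τ s p.edges.length).edges :=
      List.ext_getElem (hlen _).symm fun i h2 h3 => (hp i h2).symm.trans (hpre _ i h3)
    have h2 := hstart p.edges.length
    generalize playPath σ τ s p.edges.length = q at h1 h2
    cases p
    cases q
    simp only at h1 h2 hs
    subst h1 h2 hs
    rfl
  have h0 : source (P 0) = s := source_nextEdge _ _ _
  have hstep : ∀ n, source (P (n + 1)) = target (P n) := fun n =>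
    (source_nextEdge σ τ _).trans (Path.last_snoc _ _ _)
  refine ⟨P, ⟨h0, hstep, fun p hp hs hp' => ?_⟩, h0, hstep, fun p hp hs hp' => ?_⟩
  · change nextEdge σ τ (playPath σ τ s p.edges.length) = _
    rw [← huniq p hs hp']
    exact dif_pos hp
  · change nextEdge σ τ (playPath σ τ s p.edges.length) = _
    rw [← huniq p hs hp']
    exact dif_neg hp

theorem maxValue_le_minValue (φ : (ℕ → A) → ℝ) (σ : G.Strategy G.VMax) (τ : G.Strategy G.VMin)
    (s : G.V) : maxValue φ σ s ≤ minValue φ τ s := by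
  obtain ⟨P, h1, h2⟩ := exists_mem_cons σ τ s
  exact (iInf₂_le P h1).trans (le_iSup₂ (f := fun P (_ : P ∈ τ.Cons s) =>
    (φ (fun n => lab (P n)) : EReal)) P h2)

end Play

/-- The strategies `σ` and `τ` guarantee the same payoff `V s` from every node `s`. -/
def Guarantee (φ : (ℕ → A) → ℝ) (σ : G.Strategy G.VMax) (τ : G.Strategy G.VMin) (V : G.V → ℝ) :
    Prop :=
  ∀ s, (∀ P ∈ σ.Cons s, V s ≤ φ fun n => lab (P n)) ∧ ∀ P ∈ τ.Cons s, φ (fun n => lab (P n)) ≤ V s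

theorem Guarantee.isEquilibrium {φ : (ℕ → A) → ℝ} {σ : G.Strategy G.VMax}
    {τ : G.Strategy G.VMin} {V : G.V → ℝ} (h : Guarantee φ σ τ V) : IsEquilibrium φ σ τ := by
  intro s
  refine (maxValue_le_minValue φ σ τ s).antisymm ?_
  exact (iSup₂_le fun P hP => EReal.coe_le_coe_iff.2 ((h s).2 P hP)).trans
    (le_iInf₂ fun P hP => EReal.coe_le_coe_iff.2 ((h s).1 P hP))

/-- A guarantee is a pair of inequalities on individual plays, without averaging, so monotone maps
preserve it. -/
theorem Guarantee.comp {φ : (ℕ → A) → ℝ} {σ : G.Strategy G.VMax} {τ : G.Strategy G.VMin}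
    {V : G.V → ℝ} (h : Guarantee φ σ τ V) {g : ℝ → ℝ} (hg : Monotone g) :
    Guarantee (fun x => g (φ x)) σ τ fun s => g (V s) :=
  fun s => ⟨fun P hP => hg ((h s).1 P hP), fun P hP => hg ((h s).2 P hP)⟩

theorem IsEquilibrium.maxOptimal {φ : (ℕ → A) → ℝ} {σ : G.Strategy G.VMax}
    {τ : G.Strategy G.VMin} (h : IsEquilibrium φ σ τ) : MaxOptimal φ σ := fun σ' s =>
  (maxValue_le_minValue φ σ' τ s).trans_eq (h s).symm

end GameGraph

theorem PositionallyDetermined.positionalInOnePlayerGames {A : Type*} {φ : (ℕ → A) → ℝ}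
    (h : PositionallyDetermined φ) : PositionalInOnePlayerGames φ := fun G _ =>
  let ⟨σ, _, hσ, _, heq⟩ := h G
  ⟨σ, hσ, heq.maxOptimal⟩

/-- Both players follow `best`. Along a play consistent with Max's strategy the Bellman solution is
a lower potential: by equality at Max's nodes and by minimality at Min's. Min's side is the same
statement for −φ. -/
theorem IsMultiDiscounted.exists_guarantee {A : Type*} [Finite A] {φ : (ℕ → A) → ℝ}
    {lam w : A → ℝ} {Λ : ℝ} (h : IsMultiDiscounted φ lam w Λ) {C : ℝ} (hC : ∀ x, |φ x| ≤ C)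
    (G : GameGraph A) : ∃ (σ : G.Strategy G.VMax) (τ : G.Strategy G.VMin) (V : G.V → ℝ),
      σ.Positional ∧ τ.Positional ∧ GameGraph.Guarantee φ σ τ V := by
  have := G.finite_V
  have := Fintype.ofFinite G.V
  obtain ⟨V, best, hsrc, hbest, hmax, hmin⟩ := exists_bellman (GameGraph.source (G := G))
    (fun s => let ⟨a, t, he⟩ := G.exists_edge s; ⟨⟨(s, a, t), he⟩, rfl⟩) G.VMax
    (fun e V => w (GameGraph.lab e) + lam (GameGraph.lab e) * V (GameGraph.target e))
    h.nonneg h.lt_one (fun e V V' => by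
      rw [add_sub_add_left_eq_sub, ← mul_sub, abs_mul, abs_of_nonneg (h.lam_nonneg _)]
      exact mul_le_mul (h.lam_le _) (dist_le_pi_dist V V' _) (abs_nonneg _) h.nonneg)
  obtain ⟨D, hD⟩ : ∃ D, ∀ s, |V s| ≤ D := by
    obtain ⟨D, hD⟩ := (Set.finite_range fun s => |V s|).bddAbove
    exact ⟨D, fun s => hD ⟨s, rfl⟩⟩
  refine ⟨.ofPositional _ best hsrc, .ofPositional _ best hsrc, V,
    GameGraph.Strategy.positional_ofPositional _ _ _,
    GameGraph.Strategy.positional_ofPositional _ _ _, fun s => ⟨fun P hP => ?_, fun P hP => ?_⟩⟩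
  · rw [← hP.1]
    refine h.le_of_le_step (B := D + C) (fun n => V (GameGraph.source (P n)))
      (fun n => GameGraph.lab (P n)) (fun n y => ?_) fun n => ?_
    · linarith [(abs_le.1 (hD (GameGraph.source (P n)))).2, (abs_le.1 (hC y)).1]
    · simp only [hP.2.1]
      by_cases hn : GameGraph.source (P n) ∈ G.VMax
      · rw [← hbest (GameGraph.source (P n)),
          ← GameGraph.Strategy.eq_of_mem_cons_ofPositional hP n hn]
      · exact hmin _ hn
  · rw [← hP.1, ← neg_le_neg_iff]
    refine h.neg.le_of_le_step (B := D + C) (fun n => -V (GameGraph.source (P n)))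
      (fun n => GameGraph.lab (P n)) (fun n y => ?_) fun n => ?_
    · linarith [(abs_le.1 (hD (GameGraph.source (P n)))).1, (abs_le.1 (hC y)).2]
    · simp only [hP.2.1]
      by_cases hn : GameGraph.source (P n) ∈ G.VMax
      · linarith [hmax _ hn]
      · have h1 := hbest (GameGraph.source (P n))
        rw [← GameGraph.Strategy.eq_of_mem_cons_ofPositional hP n hn] at h1
        linarith

/-! ### A monotone transformation of a discounted payoff -/

/-- The discounted payoff with discount factor `1 / 2` and rewards `0` and `1`. -/
noncomputable def binaryPayoff (x : ℕ → Bool) : ℝ :=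
  ∑' n, (1 / 2 : ℝ) ^ n * cond (x n) 1 0

theorem binaryPayoff_term_bound (x : ℕ → Bool) (n : ℕ) :
    ‖(1 / 2 : ℝ) ^ n * cond (x n) 1 0‖ ≤ (1 / 2 : ℝ) ^ n := by
  cases x n <;> simp

theorem summable_binaryPayoff (x : ℕ → Bool) :
    Summable fun n => (1 / 2 : ℝ) ^ n * cond (x n) 1 0 :=
  Summable.of_norm_bounded summable_geometric_two (binaryPayoff_term_bound x)

theorem continuous_binaryPayoff : ContinuousPayoff binaryPayoff := by
  let _ : TopologicalSpace Bool := ⊥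
  have : DiscreteTopology Bool := ⟨rfl⟩
  refine continuous_tsum (fun n => ?_) summable_geometric_two fun n x =>
    binaryPayoff_term_bound x n
  exact continuous_const.mul ((continuous_of_discreteTopology
    (f := fun b : Bool => cond b (1 : ℝ) 0)).comp (continuous_apply n))

theorem isMultiDiscounted_binaryPayoff :
    IsMultiDiscounted binaryPayoff (fun _ => 1 / 2) (fun b => cond b 1 0) (1 / 2) := by
  refine ⟨fun _ => by norm_num, fun _ => le_rfl, by norm_num, by norm_num, fun a x => ?_⟩
  rw [binaryPayoff, (summable_binaryPayoff _).tsum_eq_zero_add, binaryPayoff, ← tsum_mul_left]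
  simp [pow_succ', mul_assoc]

/-- The words 000…, 1000… and 11000… have discounted payoffs 0, 1 and 3/2. For the cubes the
recursion would force w(1) = 1 and λ(1) = 27/8 − 1 > 1. -/
theorem not_multiDiscounted_binaryPayoff_pow_three :
    ¬ MultiDiscounted fun x => binaryPayoff x ^ 3 := by
  intro h
  obtain ⟨lam, w, Λ, h⟩ := h.exists_isMultiDiscounted
  have h0 : binaryPayoff (fun _ => false) = 0 := by simp [binaryPayoff]
  have hb := isMultiDiscounted_binaryPayoff.apply_consWord true
  have h1 := h.apply_consWord true fun _ => false
  have h2 := h.apply_consWord true (consWord true fun _ => false)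
  simp only [hb, h0, cond_true] at h1 h2
  have h3 := (h.lam_le true).trans_lt h.lt_one
  norm_num at h1 h2
  linarith

theorem theorem7p1 :
    (∀ (A : Type*) [Finite A] (φ : (ℕ → A) → ℝ), ContinuousPayoff φ →
      (PositionallyDeterminedInMDPs φ ↔ MultiDiscounted φ)) ∧
    (∃ (A : Type) (_ : Finite A) (φ : (ℕ → A) → ℝ), ContinuousPayoff φ ∧
      PositionallyDetermined φ ∧ PositionalInOnePlayerGames φ ∧
      ¬ PositionallyDeterminedInMDPs φ) := by
  refine ⟨fun A _ φ hφ => ⟨fun h => h.multiDiscounted hφ, fun h => ?_⟩, ?_⟩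
  · obtain ⟨lam, w, Λ, h⟩ := h.exists_isMultiDiscounted
    exact h.positionallyDeterminedInMDPs hφ
  · have hcont : ContinuousPayoff fun x => binaryPayoff x ^ 3 :=
      Continuous.pow (f := binaryPayoff) continuous_binaryPayoff 3
    have hdet : PositionallyDetermined fun x => binaryPayoff x ^ 3 := fun G => by
      obtain ⟨C, -, hC⟩ := continuous_binaryPayoff.exists_bound
      obtain ⟨σ, τ, V, hσ, hτ, h⟩ := isMultiDiscounted_binaryPayoff.exists_guarantee hC G
      exact ⟨σ, τ, hσ, hτ,
        (h.comp (g := fun t => t ^ 3) (Odd.strictMono_pow (by decide)).monotone).isEquilibrium⟩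
    exact ⟨Bool, inferInstance, _, hcont, hdet, hdet.positionalInOnePlayerGames, fun h =>
      not_multiDiscounted_binaryPayoff_pow_three (h.multiDiscounted hcont)⟩
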